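/- Let $d,n\ge 1$ and let $\theta^1,\dots,\theta^n$ be i.i.d. random vectors in $\mathbf R^d$ with distribution $\mathcal P^*$, mean $\theta^*$ and positive definite covariance matrix $\Sigma^*$. Put $\Delta=\Sigma^{*-1/2}(\theta-\theta^*)$ for $\theta\sim\mathcal P^*$, and let $\tau'$ be a real number such that $E[\Delta_j^6]$ is finite and at most $\tau'$ for every $j=1,\dots,d$. Let $$\hat\theta_n=\frac1n\sum_{i=1}^n\theta^i,\qquad \hat\Sigma_n=\frac1n\sum_{i=1}^n(\theta^i-\hat\theta_n)(\theta^i-\hat\theta_n)^\top .$$ Let $c_1=400$ be the value at $d=1$ of the Berry–Esseen constant $c_d=400\,d^{1/4}$, and let $\chi_1^{-1}(p)$, for $p<1$, be the quantile function of the chi distribution with one degree of freedom (the law of $|W|$ for $W\sim\mathcal N(0,1)$), that is, the least $x\ge 0$ with $\mathrm{Prob}(|W|\le x)\ge p$. For $\delta'>0$ define $$\eta_{d,n}(\delta')=\frac{\tau'^{1/3}\,d}{\sqrt n}\;\chi_1^{-1}\!\left(1-\frac{\delta'}{d^2}+\frac{c_1\tau'}{\sqrt n}\right)$$ whenever the argument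 of $\chi_1^{-1}$ is less than $1$. Then for every $\delta'>0$ for which $\eta_{d,n}(\delta')$ is defined, and with $\delta'\le 1/2$ in case $d=1$, the following holds with probability at least $1-\delta'$: $$\bigl(1-\eta_{d,n}(\delta')\bigr)\Sigma^*\;\preceq\;\hat\Sigma_n\;\preceq\;\bigl(1+\eta_{d,n}(\delta')\bigr)\Sigma^* ,$$ where $A\preceq B$ means that $B-A$ is positive semidefinite. -/

import Mathlib

open MeasureTheory ProbabilityTheory
open scoped MatrixOrder

noncomputable section

/-- The mean vector of a distribution on `ℝ^d`. -/
def meanVec {d : ℕ} (P : Measure (Fin d → ℝ)) : Fin d → ℝ :=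
  fun j => ∫ t, t j ∂P

/-- The covariance matrix `E[(t - m)(t - m)ᵀ]` of a distribution on `ℝ^d` with mean `m`. -/
def covMat {d : ℕ} (P : Measure (Fin d → ℝ)) : Matrix (Fin d) (Fin d) ℝ :=
  fun j k => ∫ t, (t j - meanVec P j) * (t k - meanVec P k) ∂P

/-- The standardized vector `Σ^{-1/2} (t - m)`, where `m` and `Σ` are the mean and the
covariance matrix of `P` and `Σ^{1/2}` is the positive semidefinite square root. -/
def standardize {d : ℕ} (P : Measure (Fin d → ℝ)) (t : Fin d → ℝ) : Fin d → ℝ :=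
  ((CFC.sqrt (covMat P))⁻¹).mulVec (t - meanVec P)

/-- The empirical mean of `n` points of `ℝ^d`. -/
def sampleMean {n d : ℕ} (x : Fin n → Fin d → ℝ) : Fin d → ℝ :=
  (1 / (n : ℝ)) • ∑ i, x i

/-- The empirical covariance matrix `(1/n) ∑ (xᵢ - x̄)(xᵢ - x̄)ᵀ`, centred at the empirical
mean `x̄`. -/
def sampleCov {n d : ℕ} (x : Fin n → Fin d → ℝ) : Matrix (Fin d) (Fin d) ℝ :=
  (1 / (n : ℝ)) • ∑ i, Matrix.vecMulVec (x i - sampleMean x) (x i - sampleMean x)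

/-- The chi distribution with `k` degrees of freedom: the law of the Euclidean norm of a
standard Gaussian vector in `ℝ^k`. -/
def chiMeasure (k : ℕ) : Measure ℝ :=
  (Measure.pi fun _ : Fin k => gaussianReal 0 1).map fun w => √(∑ i, w i ^ 2)

/-- The quantile function of the chi distribution with `k ≥ 1` degrees of freedom at a level
`p < 1` (for `p ≥ 1` the set is empty, so the value is meaningless there). -/
def chiQuantile (k : ℕ) (p : ℝ) : ℝ :=
  sInf {x : ℝ | 0 ≤ x ∧ p ≤ cdf (chiMeasure k) x}

/-- The Berry-Esseen constant `c_d = 400 d^{1/4}` for convex sets in `ℝ^d`. -/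
def beConst (d : ℕ) : ℝ := 400 * (d : ℝ) ^ (1 / 4 : ℝ)

/-- The level at which the chi quantile is taken in the covariance error. -/
def covLevel (d n : ℕ) (τ' δ' : ℝ) : ℝ :=
  1 - δ' / (d : ℝ) ^ 2 + beConst 1 * τ' / √(n : ℝ)

/-- The relative error `η_{d,n}(δ')` of the empirical covariance matrix. -/
def covError (d n : ℕ) (τ' δ' : ℝ) : ℝ :=
  τ' ^ (1 / 3 : ℝ) * d / √(n : ℝ) * chiQuantile 1 (covLevel d n τ' δ')

end

/-!
In the coordinates `Y = Σ^{-1/2} (θ - m)` the claim says that the quadratic form of the sample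
covariance of the `Y i` differs from the identity by at most `η = d r`, where
`r = τ'^{1/3} q / √n` and `q` is the chi quantile. The sample covariance is the second-moment matrix
minus the rank-one matrix of the sample mean. Suppose that every off-diagonal entry of
(second-moment matrix - identity) is at most `r`, every diagonal entry at most `9/10 r`, and the
squared norm of the sample mean at most `1/10 r`. Then the operator norm of the difference is at
most `(d - 1/10) r + 1/10 r = d r` (`loewner_of_entries`). The smaller diagonal tolerance is
affordable, since `E Y_j² = 1` and `E Y_j⁶ ≤ τ'` make the variance of `Y_j²` at most
`(9/10)² τ'^{2/3}` (`integral_diag_moments`), and the mean is controlled by Markov's inequality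
(`measureReal_mean_le`). There are `d²` entries, each allowed the probability
`P(|N| > q) ≤ δ'/d² - 400 τ'/√n`, so what remains is a Berry–Esseen bound for each entry, with a
total error that fits into `400 τ'/√n`.

The required bound `measureReal_lt_abs_sum_le` concerns a sum `W` of i.i.d. centred variables
whose variance `σ²` is at most `1` but may be much smaller, so the usual error
`E|ξ|³ / σ³` is not good enough. It is proved by Stein's method for the two-sided indicator
`1{|x| > q}`. The bounded solution `f` of `f' x = x f x + 1{|x| > q} - P(|N| > q)` satisfies
`f' ≤ -P(|N| > q)` inside `[-q, q]`, and outside it `f'` is bounded strictly below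
`1 - P(|N| > q)` by Mills' ratio. Writing the difference of tails as
`(1 - σ²) E f'(W) + (σ² E f'(W) - E W f(W))`, these bounds allow the first term to be absorbed in
the left-hand side, for every `σ² ≤ 1`. The second term is expanded by leaving out one summand at
a time (`abs_stein_step_le`). The smooth part costs a third moment, and the jump of `f'` at `±q`
costs the probability that the remaining sum is close to `±q`, which is bounded by testing
`E W φ(W)` with an odd ramp function `φ` (`sum_integral_nearInd_le`); because `q ≥ 3/5` this
concentration bound does not deteriorate for small `σ` either.
-/

namespace SteinTail

open Set Filter Topology

/-! ### The Gaussian integral and Mills' ratio -/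

/-- The unnormalized Gaussian integral `∫₀ˣ exp (-t² / 2) dt`. -/
noncomputable def gaussInt (x : ℝ) : ℝ := ∫ t in (0 : ℝ)..x, Real.exp (-t ^ 2 / 2)

/-- The limit `√(2π) / 2` of `gaussInt` at infinity. -/
noncomputable def gaussTotal : ℝ := √(2 * Real.pi) / 2

/-- The two-sided tail `Prob(|N| > q)` of a standard Gaussian `N`, for `q ≥ 0`. -/
noncomputable def normalTail (q : ℝ) : ℝ := 1 - gaussInt q / gaussTotal

lemma gaussTotal_pos : 0 < gaussTotal := by
  unfold gaussTotal; positivity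

lemma hasDerivAt_gaussInt (x : ℝ) : HasDerivAt gaussInt (Real.exp (-x ^ 2 / 2)) x := by
  have hc : Continuous fun t : ℝ => Real.exp (-t ^ 2 / 2) := by fun_prop
  exact intervalIntegral.integral_hasDerivAt_right (hc.intervalIntegrable _ _)
    (hc.stronglyMeasurableAtFilter _ _) hc.continuousAt

lemma continuous_gaussInt : Continuous gaussInt :=
  continuous_iff_continuousAt.2 fun x => (hasDerivAt_gaussInt x).continuousAt

@[simp] lemma gaussInt_zero : gaussInt 0 = 0 := by simp [gaussInt]

lemma gaussInt_neg (x : ℝ) : gaussInt (-x) = -gaussInt x := by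
  unfold gaussInt
  have h := intervalIntegral.integral_comp_neg (a := 0) (b := x)
    (fun t : ℝ => Real.exp (-t ^ 2 / 2))
  simp only [neg_zero, even_two, Even.neg_pow] at h
  rw [h, intervalIntegral.integral_symm]

lemma strictMono_gaussInt : StrictMono gaussInt :=
  strictMono_of_deriv_pos fun x => by
    rw [(hasDerivAt_gaussInt x).deriv]; positivity

lemma gaussInt_nonneg {x : ℝ} (hx : 0 ≤ x) : 0 ≤ gaussInt x := by
  simpa using strictMono_gaussInt.monotone hx

lemma tendsto_gaussInt : Tendsto gaussInt atTop (𝓝 gaussTotal) := by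
  have hi : Integrable (fun t : ℝ => Real.exp (-(1 / 2) * t ^ 2)) :=
    integrable_exp_neg_mul_sq (by norm_num)
  have h := intervalIntegral_tendsto_integral_Ioi (μ := volume) (0 : ℝ)
    hi.integrableOn (tendsto_id (α := ℝ) (x := atTop))
  rw [integral_gaussian_Ioi] at h
  have e : gaussInt = fun x => ∫ t in (0 : ℝ)..id x, Real.exp (-(1 / 2) * t ^ 2) := by
    funext x
    unfold gaussInt
    congr 1
    funext t
    congr 1
    ring
  rw [e]
  convert h using 2
  unfold gaussTotal
  congr 2
  ring

lemma gaussInt_lt_total (x : ℝ) : gaussInt x < gaussTotal :=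
  (strictMono_gaussInt (lt_add_one x)).trans_le
    (strictMono_gaussInt.monotone.ge_of_tendsto tendsto_gaussInt _)

lemma tendsto_exp_neg_sq : Tendsto (fun x : ℝ => Real.exp (-x ^ 2 / 2)) atTop (𝓝 0) := by
  refine Real.tendsto_exp_atBot.comp ?_
  have h : Tendsto (fun x : ℝ => x ^ 2 / 2) atTop atTop :=
    (tendsto_pow_atTop two_ne_zero).atTop_div_const (by norm_num)
  refine (tendsto_neg_atTop_atBot.comp h).congr fun x => ?_
  simp only [Function.comp_apply]
  ring

/-- A function on `(0, ∞)` with nonnegative derivative and limit `0` at infinity is `≤ 0`. -/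
lemma nonpos_of_deriv_nonneg_of_tendsto_zero {F F' : ℝ → ℝ}
    (hF : ∀ x, 0 < x → HasDerivAt F (F' x) x) (hF' : ∀ x, 0 < x → 0 ≤ F' x)
    (hlim : Tendsto F atTop (𝓝 0)) {x : ℝ} (hx : 0 < x) : F x ≤ 0 := by
  have hm : MonotoneOn F (Ioi 0) := by
    refine monotoneOn_of_deriv_nonneg (convex_Ioi 0)
      (fun y hy => (hF y hy).continuousAt.continuousWithinAt) ?_ ?_
    · rw [interior_Ioi]
      exact fun y hy => (hF y hy).differentiableAt.differentiableWithinAt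
    · rw [interior_Ioi]
      intro y hy
      rw [(hF y hy).deriv]
      exact hF' y hy
  refine ge_of_tendsto hlim ?_
  filter_upwards [eventually_ge_atTop x] with y hy
  exact hm hx (hx.trans_le hy) hy

lemma hasDerivAt_exp_neg_sq (x : ℝ) :
    HasDerivAt (fun t : ℝ => Real.exp (-t ^ 2 / 2)) (-x * Real.exp (-x ^ 2 / 2)) x := by
  have h : HasDerivAt (fun t : ℝ => -t ^ 2 / 2) (-x) x := by
    refine (((hasDerivAt_pow 2 x).neg).div_const 2).congr_deriv ?_
    simp; ring
  exact h.exp.congr_deriv (by ring)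

/-- Upper Mills bound `x ∫ₓ^∞ exp (-t² / 2) dt ≤ exp (-x² / 2)`. -/
lemma mul_gauss_tail_le {x : ℝ} (hx : 0 < x) :
    x * (gaussTotal - gaussInt x) ≤ Real.exp (-x ^ 2 / 2) := by
  have h := nonpos_of_deriv_nonneg_of_tendsto_zero
    (F := fun x => gaussTotal - gaussInt x - Real.exp (-x ^ 2 / 2) * x⁻¹)
    (F' := fun x => Real.exp (-x ^ 2 / 2) * (x ^ 2)⁻¹)
    (fun y hy => by
      refine ((((hasDerivAt_gaussInt y).const_sub gaussTotal)).sub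
        ((hasDerivAt_exp_neg_sq y).mul (hasDerivAt_inv hy.ne'))).congr_deriv ?_
      field_simp
      ring)
    (fun y hy => by positivity)
    (by
      have h1 := (tendsto_const_nhds (x := gaussTotal)).sub tendsto_gaussInt
      have h2 := tendsto_exp_neg_sq.mul (tendsto_inv_atTop_zero (𝕜 := ℝ))
      simpa using h1.sub h2) hx
  have h' : gaussTotal - gaussInt x ≤ Real.exp (-x ^ 2 / 2) * x⁻¹ := by linarith
  calc x * (gaussTotal - gaussInt x) ≤ x * (Real.exp (-x ^ 2 / 2) * x⁻¹) := by gcongr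
    _ = _ := by field_simp

/-- Lower Mills bound `x/(1+x²) exp (-x² / 2) ≤ ∫ₓ^∞ exp (-t² / 2) dt`. -/
lemma exp_le_mul_gauss_tail {x : ℝ} (hx : 0 < x) :
    x ^ 2 / (1 + x ^ 2) * Real.exp (-x ^ 2 / 2) ≤ x * (gaussTotal - gaussInt x) := by
  have h := nonpos_of_deriv_nonneg_of_tendsto_zero
    (F := fun x => Real.exp (-x ^ 2 / 2) * (x / (1 + x ^ 2)) - (gaussTotal - gaussInt x))
    (F' := fun x => Real.exp (-x ^ 2 / 2) * (2 / (1 + x ^ 2) ^ 2))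
    (fun y hy => by
      have hd : HasDerivAt (fun t : ℝ => t / (1 + t ^ 2))
          ((1 * (1 + y ^ 2) - y * (2 * y)) / (1 + y ^ 2) ^ 2) y := by
        have h2 : HasDerivAt (fun t : ℝ => 1 + t ^ 2) (2 * y) y := by
          simpa using (hasDerivAt_pow 2 y).const_add 1
        exact (hasDerivAt_id y).div h2 (by positivity)
      refine (((hasDerivAt_exp_neg_sq y).mul hd).sub
        ((hasDerivAt_gaussInt y).const_sub gaussTotal)).congr_deriv ?_
      field_simp
      ring)
    (fun y hy => by positivity)
    (by
      have h1 := (tendsto_const_nhds (x := gaussTotal)).sub tendsto_gaussInt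
      have h2 : Tendsto (fun x : ℝ => Real.exp (-x ^ 2 / 2) * (x / (1 + x ^ 2))) atTop (𝓝 0) := by
        refine squeeze_zero' ?_ ?_ tendsto_exp_neg_sq
        · filter_upwards [eventually_ge_atTop 0] with y hy
          positivity
        · filter_upwards [eventually_ge_atTop 0] with y hy
          refine mul_le_of_le_one_right (by positivity) ?_
          rw [div_le_one (by positivity)]
          nlinarith [sq_nonneg (y - 1)]
      simpa using h2.sub h1) hx
  have h' : Real.exp (-x ^ 2 / 2) * (x / (1 + x ^ 2)) ≤ gaussTotal - gaussInt x := by linarith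
  calc x ^ 2 / (1 + x ^ 2) * Real.exp (-x ^ 2 / 2)
      = x * (Real.exp (-x ^ 2 / 2) * (x / (1 + x ^ 2))) := by ring
    _ ≤ _ := by gcongr

lemma normalTail_pos (q : ℝ) : 0 < normalTail q := by
  unfold normalTail
  rw [sub_pos, div_lt_one gaussTotal_pos]
  exact gaussInt_lt_total q

lemma normalTail_le_one {q : ℝ} (hq : 0 ≤ q) : normalTail q ≤ 1 := by
  unfold normalTail
  have := div_nonneg (gaussInt_nonneg hq) gaussTotal_pos.le
  linarith

lemma gaussInt_eq (q : ℝ) : gaussInt q = (1 - normalTail q) * gaussTotal := by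
  unfold normalTail
  have := gaussTotal_pos
  field_simp
  ring

/-! ### The Stein equation for the two-sided tail -/

/-- The indicator of `|x| > q`. -/
noncomputable def tailInd (q x : ℝ) : ℝ := if q < |x| then 1 else 0

/-- The integral `∫₀ˣ (T - 1{|t| > q}) exp (-t² / 2) dt`, where `T = normalTail q`, in closed
form. -/
noncomputable def steinPrim (q x : ℝ) : ℝ :=
  normalTail q * gaussInt x - max 0 (gaussInt x - gaussInt q)
    + max 0 (-gaussInt x - gaussInt q)

/-- The bounded solution `f` of Stein's equation `f' x = x f x + 1{|x| > q} - T`. -/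
noncomputable def steinSol (q x : ℝ) : ℝ := -(Real.exp (x ^ 2 / 2) * steinPrim q x)

/-- The right-hand side of Stein's equation, which is the derivative of `steinSol q` away
from `±q`. -/
noncomputable def steinDeriv (q x : ℝ) : ℝ := x * steinSol q x + tailInd q x - normalTail q

lemma continuous_steinSol (q : ℝ) : Continuous (steinSol q) := by
  have := continuous_gaussInt
  unfold steinSol steinPrim
  fun_prop

lemma measurable_tailInd (q : ℝ) : Measurable (tailInd q) :=
  Measurable.ite (measurableSet_lt measurable_const (by fun_prop)) measurable_const
    measurable_const

lemma measurable_steinDeriv (q : ℝ) : Measurable (steinDeriv q) := by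
  have := (continuous_steinSol q).measurable
  have := measurable_tailInd q
  unfold steinDeriv
  fun_prop

lemma tailInd_neg (q x : ℝ) : tailInd q (-x) = tailInd q x := by simp [tailInd]

lemma steinSol_neg (q x : ℝ) : steinSol q (-x) = -steinSol q x := by
  simp only [steinSol, steinPrim, gaussInt_neg, neg_neg, even_two, Even.neg_pow]
  ring

lemma steinDeriv_neg (q x : ℝ) : steinDeriv q (-x) = steinDeriv q x := by
  simp [steinDeriv, steinSol_neg, tailInd_neg]

lemma steinPrim_of_abs_le {q x : ℝ} (h : |x| ≤ q) :
    steinPrim q x = normalTail q * gaussInt x := by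
  obtain ⟨h1, h2⟩ := abs_le.1 h
  have h3 := strictMono_gaussInt.monotone h2
  have h4 := strictMono_gaussInt.monotone h1
  rw [gaussInt_neg] at h4
  unfold steinPrim
  rw [max_eq_left (by linarith), max_eq_left (by linarith)]
  ring

lemma steinPrim_of_le {q x : ℝ} (hq : 0 ≤ q) (h : q ≤ x) :
    steinPrim q x = (1 - normalTail q) * (gaussTotal - gaussInt x) := by
  have h3 := strictMono_gaussInt.monotone h
  have h4 := gaussInt_nonneg hq
  unfold steinPrim
  rw [max_eq_right (by linarith), max_eq_left (by linarith)]
  linear_combination gaussInt_eq q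

lemma hasDerivAt_steinSol_of_prim {q x c : ℝ}
    (h : HasDerivAt (steinPrim q) (c * Real.exp (-x ^ 2 / 2)) x) :
    HasDerivAt (steinSol q) (x * steinSol q x - c) x := by
  have h1 : HasDerivAt (fun t : ℝ => Real.exp (t ^ 2 / 2)) (x * Real.exp (x ^ 2 / 2)) x := by
    have h2 : HasDerivAt (fun t : ℝ => t ^ 2 / 2) x x := by
      refine ((hasDerivAt_pow 2 x).div_const 2).congr_deriv ?_
      simp
    exact h2.exp.congr_deriv (by ring)
  refine (h1.mul h).neg.congr_deriv ?_
  have e : Real.exp (x ^ 2 / 2) * Real.exp (-x ^ 2 / 2) = 1 := by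
    rw [← Real.exp_add]; simp; ring
  unfold steinSol
  linear_combination -c * e

lemma hasDerivAt_steinSol {q x : ℝ} (hq : 0 ≤ q) (hx : |x| ≠ q) :
    HasDerivAt (steinSol q) (steinDeriv q x) x := by
  -- By oddness it suffices to treat `x ≥ 0`.
  have key : ∀ y, 0 ≤ y → y ≠ q → HasDerivAt (steinSol q) (steinDeriv q y) y := by
    intro y hy0 hy
    rcases lt_or_gt_of_ne hy with h | h
    · have hE : steinPrim q =ᶠ[𝓝 y] fun z => normalTail q * gaussInt z := by
        have : ∀ᶠ z in 𝓝 y, |z| < q :=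
          (continuous_abs.tendsto y).eventually_lt_const (by rwa [abs_of_nonneg hy0])
        filter_upwards [this] with z hz
        exact steinPrim_of_abs_le hz.le
      have := hasDerivAt_steinSol_of_prim
        (((hasDerivAt_gaussInt y).const_mul (normalTail q)).congr_of_eventuallyEq hE)
      convert this using 1
      simp [steinDeriv, tailInd, abs_of_nonneg hy0, h.not_gt]
    · have hE : steinPrim q =ᶠ[𝓝 y] fun z => (1 - normalTail q) * (gaussTotal - gaussInt z) := by
        filter_upwards [eventually_gt_nhds h] with z hz
        exact steinPrim_of_le hq hz.le
      have := hasDerivAt_steinSol_of_prim (c := normalTail q - 1)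
        (((((hasDerivAt_gaussInt y).const_sub gaussTotal).const_mul
          (1 - normalTail q)).congr_of_eventuallyEq hE).congr_deriv (by ring))
      convert this using 1
      simp only [steinDeriv, tailInd, abs_of_nonneg hy0, h, if_true]
      ring
  rcases le_total 0 x with h0 | h0
  · exact key x h0 (by rwa [abs_of_nonneg h0] at hx)
  · have h := key (-x) (by linarith) (by rwa [abs_of_nonpos h0] at hx)
    have h2 := (HasDerivAt.comp x h (hasDerivAt_neg x)).neg
    rw [steinDeriv_neg] at h2
    have e : -steinSol q ∘ Neg.neg = steinSol q := by
      funext z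
      simp [steinSol_neg]
    rw [e] at h2
    exact h2.congr_deriv (by ring)

lemma exp_mul_exp_neg (x : ℝ) : Real.exp (x ^ 2 / 2) * Real.exp (-x ^ 2 / 2) = 1 := by
  rw [← Real.exp_add]; simp; ring

/-- On `[q, ∞)`, `-x f x` lies between `(1 - T) x² / (1 + x²)` and `1 - T`. -/
lemma neg_mul_steinSol_mem {q x : ℝ} (hq : 0 < q) (h : q ≤ x) :
    -(x * steinSol q x) ≤ 1 - normalTail q ∧
      (1 - normalTail q) * (x ^ 2 / (1 + x ^ 2)) ≤ -(x * steinSol q x) := by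
  have hx : 0 < x := hq.trans_le h
  have hT := normalTail_le_one hq.le
  have e : -(x * steinSol q x) = (1 - normalTail q) *
      (Real.exp (x ^ 2 / 2) * (x * (gaussTotal - gaussInt x))) := by
    rw [steinSol, steinPrim_of_le hq.le h]; ring
  rw [e]
  have he := exp_mul_exp_neg x
  constructor
  · have : Real.exp (x ^ 2 / 2) * (x * (gaussTotal - gaussInt x)) ≤ 1 := by
      rw [← he]; gcongr; exact mul_gauss_tail_le hx
    exact mul_le_of_le_one_right (by linarith) this
  · refine mul_le_mul_of_nonneg_left ?_ (by linarith)
    calc x ^ 2 / (1 + x ^ 2) = Real.exp (x ^ 2 / 2) *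
          (x ^ 2 / (1 + x ^ 2) * Real.exp (-x ^ 2 / 2)) := by
          linear_combination -(x ^ 2 / (1 + x ^ 2)) * he
      _ ≤ _ := mul_le_mul_of_nonneg_left (exp_le_mul_gauss_tail hx) (Real.exp_pos _).le

lemma neg_steinSol_mem_of_le {q x : ℝ} (hx0 : 0 ≤ x) (h : x ≤ q) :
    0 ≤ -steinSol q x ∧ -steinSol q x ≤ -steinSol q q := by
  have hT := (normalTail_pos q).le
  have hq := hx0.trans h
  have e : ∀ y, 0 ≤ y → y ≤ q → -steinSol q y
      = Real.exp (y ^ 2 / 2) * (normalTail q * gaussInt y) := by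
    intro y hy hyq
    rw [steinSol, steinPrim_of_abs_le (by rwa [abs_of_nonneg hy])]; ring
  rw [e x hx0 h, e q hq le_rfl]
  have := gaussInt_nonneg hx0
  have := strictMono_gaussInt.monotone h
  exact ⟨by positivity, by gcongr⟩

lemma abs_steinSol_le {q : ℝ} (hq : 0 < q) (x : ℝ) : |steinSol q x| ≤ 1 / q := by
  have hT := (normalTail_pos q).le
  have hT1 := normalTail_le_one hq.le
  have key : ∀ y, 0 ≤ y → |steinSol q y| ≤ 1 / q := by
    have h1 : ∀ y, q ≤ y → 0 ≤ -steinSol q y ∧ -steinSol q y ≤ 1 / q := by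
      intro y hy
      have hy0 : 0 < y := hq.trans_le hy
      obtain ⟨ha, hb⟩ := neg_mul_steinSol_mem hq hy
      have hb' : 0 ≤ -(y * steinSol q y) :=
        (mul_nonneg (by linarith) (by positivity)).trans hb
      have h0 : 0 ≤ -steinSol q y := by
        by_contra! hc
        nlinarith
      refine ⟨h0, ?_⟩
      rw [le_div_iff₀ hq]
      nlinarith
    intro y hy
    rw [← abs_neg, abs_of_nonneg]
    · rcases le_total q y with h | h
      · exact (h1 y h).2
      · exact (neg_steinSol_mem_of_le hy h).2.trans (h1 q le_rfl).2
    · rcases le_total q y with h | h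
      · exact (h1 y h).1
      · exact (neg_steinSol_mem_of_le hy h).1
  rcases le_total 0 x with h | h
  · exact key x h
  · have := key (-x) (by linarith)
    rwa [steinSol_neg, abs_neg] at this

/-- Bounds for the Stein derivative inside `[-q, q]`. -/
lemma steinDeriv_mem_of_abs_le {q x : ℝ} (hq : 0 < q) (h : |x| ≤ q) :
    -1 ≤ steinDeriv q x ∧ steinDeriv q x ≤ -normalTail q := by
  have key : ∀ y, 0 ≤ y → y ≤ q → -1 ≤ steinDeriv q y ∧ steinDeriv q y ≤ -normalTail q := by
    intro y hy hyq
    obtain ⟨h1, h2⟩ := neg_steinSol_mem_of_le hy hyq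
    have h3 := (neg_mul_steinSol_mem hq le_rfl).1
    simp only [steinDeriv, tailInd, abs_of_nonneg hy, hyq.not_gt, if_false]
    have h4 : y * -steinSol q y ≤ q * -steinSol q q := mul_le_mul hyq h2 h1 hq.le
    have h5 : 0 ≤ y * -steinSol q y := mul_nonneg hy h1
    constructor <;> linarith
  rcases le_total 0 x with h0 | h0
  · exact key x h0 (by rwa [abs_of_nonneg h0] at h)
  · rw [← steinDeriv_neg]
    exact key (-x) (by linarith) (by rwa [abs_of_nonpos h0] at h)

/-- Bounds for the Stein derivative outside `[-q, q]`. -/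
lemma steinDeriv_mem_of_lt_abs {q x : ℝ} (hq : 0 < q) (h : q < |x|) :
    0 ≤ steinDeriv q x ∧ steinDeriv q x ≤ (1 - normalTail q) * (1 - q ^ 2 / (1 + q ^ 2)) := by
  have key : ∀ y, 0 ≤ y → q < y → 0 ≤ steinDeriv q y ∧
      steinDeriv q y ≤ (1 - normalTail q) * (1 - q ^ 2 / (1 + q ^ 2)) := by
    intro y hy hyq
    obtain ⟨h1, h2⟩ := neg_mul_steinSol_mem hq hyq.le
    have hT1 := normalTail_le_one hq.le
    simp only [steinDeriv, tailInd, abs_of_nonneg hy, hyq, if_true]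
    have h3 : q ^ 2 / (1 + q ^ 2) ≤ y ^ 2 / (1 + y ^ 2) := by
      rw [div_le_div_iff₀ (by positivity) (by positivity)]
      nlinarith
    have h4 := mul_le_mul_of_nonneg_left h3 (sub_nonneg.2 hT1)
    constructor <;> linarith
  rcases le_total 0 x with h0 | h0
  · exact key x h0 (by rwa [abs_of_nonneg h0] at h)
  · rw [← steinDeriv_neg]
    exact key (-x) (by linarith) (by rwa [abs_of_nonpos h0] at h)

lemma abs_steinDeriv_le {q : ℝ} (hq : 0 < q) (x : ℝ) : |steinDeriv q x| ≤ 1 := by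
  have hT := (normalTail_pos q).le
  have hT1 := normalTail_le_one hq.le
  rw [abs_le]
  rcases le_or_gt |x| q with h | h
  · obtain ⟨h1, h2⟩ := steinDeriv_mem_of_abs_le hq h
    exact ⟨h1, by linarith⟩
  · obtain ⟨h1, h2⟩ := steinDeriv_mem_of_lt_abs hq h
    have : (1 - normalTail q) * (1 - q ^ 2 / (1 + q ^ 2)) ≤ 1 * 1 := by
      have h5 : q ^ 2 / (1 + q ^ 2) ≤ 1 := by
        rw [div_le_one (by positivity)]; linarith
      have h6 : 0 ≤ q ^ 2 / (1 + q ^ 2) := by positivity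
      gcongr <;> linarith
    exact ⟨by linarith, by linarith⟩

lemma intervalIntegrable_steinDeriv {q : ℝ} (hq : 0 < q) (a b : ℝ) :
    IntervalIntegrable (steinDeriv q) volume a b := by
  refine (intervalIntegrable_const (c := (1 : ℝ))).mono_fun
    (measurable_steinDeriv q).aestronglyMeasurable ?_
  filter_upwards with x
  simpa using abs_steinDeriv_le hq x

lemma integral_steinDeriv {q : ℝ} (hq : 0 < q) (a b : ℝ) :
    ∫ x in a..b, steinDeriv q x = steinSol q b - steinSol q a := by
  have key : ∀ a b, a ≤ b → ∫ x in a..b, steinDeriv q x = steinSol q b - steinSol q a := by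
    intro a b hab
    refine integral_eq_of_hasDerivAt_off_countable_of_le (steinSol q) (steinDeriv q) hab
      (s := {q, -q}) (Set.to_countable _) (continuous_steinSol q).continuousOn ?_
      (intervalIntegrable_steinDeriv hq a b)
    intro x hx
    refine hasDerivAt_steinSol hq.le fun h => hx.2 ?_
    rw [abs_eq hq.le] at h
    exact h
  rcases le_total a b with h | h
  · exact key a b h
  · rw [intervalIntegral.integral_symm, key b a h]; ring

lemma abs_steinSol_sub_le {q : ℝ} (hq : 0 < q) (a b : ℝ) :
    |steinSol q b - steinSol q a| ≤ |b - a| := by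
  rw [← integral_steinDeriv hq]
  have := intervalIntegral.norm_integral_le_of_norm_le_const (a := a) (b := b)
    (f := steinDeriv q) (C := 1) fun x _ => by simpa using abs_steinDeriv_le hq x
  simpa using this

/-- The indicator that `|w|` is within `L` of `q`. -/
noncomputable def nearInd (q L w : ℝ) : ℝ := if |(|w| - q)| ≤ L then 1 else 0

/-- The Stein derivative varies by a Lipschitz amount, except that it may jump by `1` when the
segment between the two points meets `±q`. -/
lemma abs_steinDeriv_sub_le {q : ℝ} (hq : 0 < q) (w t x y : ℝ) (ht : |t| ≤ |x|) :
    |steinDeriv q (w + t) - steinDeriv q (w + y)|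
      ≤ (|w| + 1 / q) * (|x| + |y|) + nearInd q (|x| + |y|) w := by
  have hjump : |tailInd q (w + t) - tailInd q (w + y)| ≤ nearInd q (|x| + |y|) w := by
    unfold nearInd
    have h1 := abs_add_le w t
    have h2 := abs_add_le w y
    have h3 : |w| ≤ |w + t| + |t| := by simpa using abs_sub (w + t) t
    have h4 : |w| ≤ |w + y| + |y| := by simpa using abs_sub (w + y) y
    have := abs_nonneg y
    have := abs_nonneg x
    split_ifs with h
    · unfold tailInd; split_ifs <;> simp
    · rw [not_le, lt_abs] at h
      unfold tailInd
      rcases h with h | h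
      · rw [if_pos (by linarith), if_pos (by linarith)]; simp
      · rw [if_neg (by linarith), if_neg (by linarith)]; simp
  have hsmooth : |(w + t) * steinSol q (w + t) - (w + y) * steinSol q (w + y)|
      ≤ (|w| + 1 / q) * (|x| + |y|) := by
    have e : (w + t) * steinSol q (w + t) - (w + y) * steinSol q (w + y)
        = w * (steinSol q (w + t) - steinSol q (w + y)) + t * steinSol q (w + t)
          - y * steinSol q (w + y) := by ring
    have h1 := abs_steinSol_sub_le hq (w + y) (w + t)
    have h2 : |w + t - (w + y)| ≤ |x| + |y| := by
      rw [add_sub_add_left_eq_sub]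
      exact (abs_sub t y).trans (by linarith)
    rw [e]
    calc _ ≤ |w * (steinSol q (w + t) - steinSol q (w + y))| + |t * steinSol q (w + t)|
          + |y * steinSol q (w + y)| := (abs_sub _ _).trans (by gcongr; exact abs_add_le _ _)
      _ = |w| * |steinSol q (w + t) - steinSol q (w + y)| + |t| * |steinSol q (w + t)|
          + |y| * |steinSol q (w + y)| := by simp only [abs_mul]
      _ ≤ |w| * (|x| + |y|) + |x| * (1 / q) + |y| * (1 / q) := by
          gcongr
          · exact h1.trans h2
          · exact abs_steinSol_le hq _
          · exact abs_steinSol_le hq _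
      _ = _ := by ring
  have e : steinDeriv q (w + t) - steinDeriv q (w + y)
      = ((w + t) * steinSol q (w + t) - (w + y) * steinSol q (w + y))
        + (tailInd q (w + t) - tailInd q (w + y)) := by unfold steinDeriv; ring
  rw [e]
  exact (abs_add_le _ _).trans (add_le_add hsmooth hjump)

/-- First-order expansion of the Stein solution, with the derivative taken at a perturbed
point. -/
lemma abs_steinSol_taylor {q : ℝ} (hq : 0 < q) (w x y : ℝ) :
    |steinSol q (w + x) - steinSol q w - x * steinDeriv q (w + y)|
      ≤ |x| * ((|w| + 1 / q) * (|x| + |y|) + nearInd q (|x| + |y|) w) := by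
  have e : steinSol q (w + x) - steinSol q w - x * steinDeriv q (w + y)
      = ∫ u in w..(w + x), (steinDeriv q u - steinDeriv q (w + y)) := by
    rw [intervalIntegral.integral_sub (intervalIntegrable_steinDeriv hq _ _)
      intervalIntegrable_const, integral_steinDeriv hq]
    simp
  rw [e]
  have h := intervalIntegral.norm_integral_le_of_norm_le_const (a := w) (b := w + x)
    (f := fun u => steinDeriv q u - steinDeriv q (w + y))
    (C := (|w| + 1 / q) * (|x| + |y|) + nearInd q (|x| + |y|) w) fun u hu => by
      have : |u - w| ≤ |x| := by
        have h1 := abs_sub_left_of_mem_uIcc (Set.uIoc_subset_uIcc hu)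
        simpa using h1
      simpa using abs_steinDeriv_sub_le hq w (u - w) x y this
  rw [Real.norm_eq_abs, add_sub_cancel_left] at h
  linarith

/-! ### Leave-one-out expansions for sums of independent variables -/

lemma measurable_nearInd (q : ℝ) : Measurable fun p : ℝ × ℝ => nearInd q p.1 p.2 :=
  Measurable.ite (measurableSet_le (by fun_prop) (by fun_prop)) measurable_const
    measurable_const

lemma nearInd_nonneg (q L w : ℝ) : 0 ≤ nearInd q L w := by
  unfold nearInd; split_ifs <;> simp

lemma nearInd_le_one (q L w : ℝ) : nearInd q L w ≤ 1 := by
  unfold nearInd; split_ifs <;> simp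

/-- Young's inequality, used to separate two independent copies. -/
lemma sq_mul_abs_add_abs_le (x y : ℝ) :
    x ^ 2 * (|x| + |y|) ≤ (5 / 3) * |x| ^ 3 + (1 / 3) * |y| ^ 3 := by
  rw [← sq_abs x]
  have hx := abs_nonneg x
  have hy := abs_nonneg y
  nlinarith [mul_nonneg (add_nonneg (add_nonneg hx hx) hy) (sq_nonneg (|x| - |y|))]

section Moments

variable {ν : Measure ℝ}

lemma integrable_cube_of_memLp (h3 : MemLp id 3 ν) : Integrable (fun x => |x| ^ 3) ν := by
  simpa using h3.integrable_norm_pow (p := 3) (by norm_num)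

variable [IsProbabilityMeasure ν]

lemma integrable_id_of_memLp (h3 : MemLp id 3 ν) : Integrable (fun x => x) ν :=
  h3.integrable (by norm_num)

lemma integrable_sq_of_memLp (h3 : MemLp id 3 ν) : Integrable (fun x => x ^ 2) ν :=
  (h3.mono_exponent (p := 2) (by norm_num)).integrable_sq

end Moments

/-- One leave-one-out step of Stein's method: `m` is the law of the sum of the other variables and
`ν` the law of the variable singled out. -/
lemma abs_stein_step_le {m ν : Measure ℝ} [IsProbabilityMeasure m] [IsProbabilityMeasure ν]
    {q : ℝ} (hq : 0 < q) (hm : Integrable (fun w => w) m) (h3 : MemLp id 3 ν) :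
    |∫ p, p.2 * (steinSol q (p.1 + p.2) - steinSol q p.1) ∂(m.prod ν)
        - (∫ x, x ^ 2 ∂ν) * ∫ p, steinDeriv q (p.1 + p.2) ∂(m.prod ν)|
      ≤ (∫ w, |w| ∂m + 1 / q) * (2 * ∫ x, |x| ^ 3 ∂ν)
        + ∫ z, z.1 ^ 2 * ∫ w, nearInd q (|z.1| + |z.2|) w ∂m ∂(ν.prod ν) := by
  have i1 := integrable_id_of_memLp h3
  have i2 := integrable_sq_of_memLp h3
  have i3 := integrable_cube_of_memLp h3
  have hcont := continuous_steinSol q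
  have hmd := measurable_steinDeriv q
  have hmn := measurable_nearInd q
  -- The measure of `(w, (x, y))`, where `y` is an independent copy of `x`.
  set ρ := m.prod (ν.prod ν) with hρ
  have hF1 : Integrable (fun p : ℝ × ℝ × ℝ => p.2.1 * (steinSol q (p.1 + p.2.1) - steinSol q p.1))
      ρ := by
    have hb : Integrable (fun p : ℝ × ℝ × ℝ => (2 / q) * |p.2.1|) ρ :=
      ((i1.abs.comp_fst ν).comp_snd m).const_mul _
    refine hb.mono' (by fun_prop) (ae_of_all _ fun p => ?_)
    rw [Real.norm_eq_abs, abs_mul]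
    have h1 := abs_sub (steinSol q (p.1 + p.2.1)) (steinSol q p.1)
    have h2 := abs_steinSol_le hq (p.1 + p.2.1)
    have h3 := abs_steinSol_le hq p.1
    have h4 : (2 : ℝ) / q = 1 / q + 1 / q := by ring
    rw [mul_comm, h4]
    gcongr
    linarith
  have hF2 : Integrable (fun p : ℝ × ℝ × ℝ => p.2.1 ^ 2 * steinDeriv q (p.1 + p.2.2)) ρ := by
    have hb : Integrable (fun p : ℝ × ℝ × ℝ => p.2.1 ^ 2) ρ := (i2.comp_fst ν).comp_snd m
    refine hb.mono' (by fun_prop) (ae_of_all _ fun p => ?_)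
    rw [Real.norm_eq_abs, abs_mul, abs_of_nonneg (sq_nonneg p.2.1)]
    exact mul_le_of_le_one_right (sq_nonneg _) (abs_steinDeriv_le hq _)
  have hG1 : Integrable (fun p : ℝ × ℝ × ℝ => (|p.1| + 1 / q) * (p.2.1 ^ 2 * (|p.2.1| + |p.2.2|)))
      ρ := by
    refine Integrable.mul_prod (f := fun w => |w| + 1 / q)
      (g := fun z : ℝ × ℝ => z.1 ^ 2 * (|z.1| + |z.2|)) (hm.abs.add (integrable_const _)) ?_
    have e : (fun z : ℝ × ℝ => z.1 ^ 2 * (|z.1| + |z.2|))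
        = fun z => |z.1| ^ 3 + z.1 ^ 2 * |z.2| := by
      funext z; rw [← sq_abs z.1]; ring
    rw [e]
    exact (i3.comp_fst ν).add (i2.mul_prod i1.abs)
  have hG2 : Integrable (fun p : ℝ × ℝ × ℝ => p.2.1 ^ 2 * nearInd q (|p.2.1| + |p.2.2|) p.1)
      ρ := by
    have hb : Integrable (fun p : ℝ × ℝ × ℝ => p.2.1 ^ 2) ρ := (i2.comp_fst ν).comp_snd m
    refine hb.mono' ?_ (ae_of_all _ fun p => ?_)
    · have : Measurable fun p : ℝ × ℝ × ℝ => nearInd q (|p.2.1| + |p.2.2|) p.1 :=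
        hmn.comp (f := fun p : ℝ × ℝ × ℝ => (|p.2.1| + |p.2.2|, p.1)) (by fun_prop)
      fun_prop
    · rw [Real.norm_eq_abs, abs_mul, abs_of_nonneg (sq_nonneg p.2.1),
        abs_of_nonneg (nearInd_nonneg _ _ _)]
      exact mul_le_of_le_one_right (sq_nonneg _) (nearInd_le_one _ _ _)
  have e1 : ∫ p, p.2 * (steinSol q (p.1 + p.2) - steinSol q p.1) ∂(m.prod ν)
      = ∫ p, p.2.1 * (steinSol q (p.1 + p.2.1) - steinSol q p.1) ∂ρ := by
    have hmp : MeasurePreserving (Prod.map (id : ℝ → ℝ) (Prod.fst : ℝ × ℝ → ℝ)) ρ (m.prod ν) :=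
      (MeasurePreserving.id m).prod (measurePreserving_fst (μ := ν) (ν := ν))
    rw [← hmp.map_eq, integral_map hmp.measurable.aemeasurable (by fun_prop)]
    rfl
  have e2 : (∫ x, x ^ 2 ∂ν) * ∫ p, steinDeriv q (p.1 + p.2) ∂(m.prod ν)
      = ∫ p, p.2.1 ^ 2 * steinDeriv q (p.1 + p.2.2) ∂ρ := by
    rw [← integral_prod_mul]
    -- Exchange the two copies of `ν`: `(x, (w, y)) ↦ (w, (x, y))`.
    have hmp : MeasurePreserving (fun p : ℝ × ℝ × ℝ => (p.2.1, (p.1, p.2.2)))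
        (ν.prod (m.prod ν)) ρ := by
      have a1 := (measurePreserving_prodAssoc ν m ν).symm MeasurableEquiv.prodAssoc
      have a2 := (Measure.measurePreserving_swap (μ := ν) (ν := m)).prod (MeasurePreserving.id ν)
      exact (measurePreserving_prodAssoc m ν ν).comp (a2.comp a1)
    rw [← hmp.map_eq, integral_map hmp.measurable.aemeasurable (by fun_prop)]
  rw [e1, e2, ← integral_sub hF1 hF2]
  have hpt : ∀ p : ℝ × ℝ × ℝ,
      ‖p.2.1 * (steinSol q (p.1 + p.2.1) - steinSol q p.1)
        - p.2.1 ^ 2 * steinDeriv q (p.1 + p.2.2)‖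
      ≤ (|p.1| + 1 / q) * (p.2.1 ^ 2 * (|p.2.1| + |p.2.2|))
        + p.2.1 ^ 2 * nearInd q (|p.2.1| + |p.2.2|) p.1 := by
    intro p
    have h := abs_steinSol_taylor hq p.1 p.2.1 p.2.2
    rw [Real.norm_eq_abs]
    calc _ = |p.2.1| * |steinSol q (p.1 + p.2.1) - steinSol q p.1
          - p.2.1 * steinDeriv q (p.1 + p.2.2)| := by rw [← abs_mul]; ring_nf
      _ ≤ |p.2.1| * (|p.2.1| * ((|p.1| + 1 / q) * (|p.2.1| + |p.2.2|)
          + nearInd q (|p.2.1| + |p.2.2|) p.1)) := by gcongr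
      _ = _ := by rw [← sq_abs p.2.1]; ring
  refine (norm_integral_le_of_norm_le (hG1.add hG2) (ae_of_all _ hpt)).trans ?_
  simp only [Pi.add_apply]
  rw [integral_add hG1 hG2]
  refine add_le_add ?_ (le_of_eq ?_)
  · rw [integral_prod_mul (fun w => |w| + 1 / q)
      (fun z : ℝ × ℝ => z.1 ^ 2 * (|z.1| + |z.2|)), integral_add hm.abs (integrable_const _)]
    simp only [integral_const, probReal_univ, one_smul]
    refine mul_le_mul_of_nonneg_left ?_ (add_nonneg (by positivity) (by positivity))
    have j1 : Integrable (fun z : ℝ × ℝ => (5 / 3) * |z.1| ^ 3) (ν.prod ν) :=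
      (i3.comp_fst ν).const_mul _
    have j2 : Integrable (fun z : ℝ × ℝ => (1 / 3) * |z.2| ^ 3) (ν.prod ν) :=
      (i3.comp_snd ν).const_mul _
    refine (integral_mono_of_nonneg (ae_of_all _ fun z => by positivity) (j1.add j2)
      (ae_of_all _ fun z => sq_mul_abs_add_abs_le z.1 z.2)).trans ?_
    simp only [Pi.add_apply]
    rw [integral_add j1 j2, integral_const_mul, integral_const_mul,
      integral_fun_fst (fun x : ℝ => |x| ^ 3), integral_fun_snd (fun x : ℝ => |x| ^ 3)]
    simp only [probReal_univ, one_smul]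
    linarith
  · rw [hρ, integral_prod_symm _ hG2]
    simp only [integral_const_mul]

section Sums

variable {Ω : Type*} [MeasurableSpace Ω] {μ : Measure Ω} {n : ℕ} {ξ : Fin n → Ω → ℝ}
  {ν : Measure ℝ}

/-- The law of the sum of all variables except the `i`-th one. -/
noncomputable def restLaw (μ : Measure Ω) (ξ : Fin n → Ω → ℝ) (i : Fin n) : Measure ℝ :=
  μ.map fun ω => ∑ j ∈ Finset.univ.erase i, ξ j ω

lemma aemeasurable_sum_of_law (hlaw : ∀ i, HasLaw (ξ i) ν μ) (s : Finset (Fin n)) :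
    AEMeasurable (fun ω => ∑ j ∈ s, ξ j ω) μ :=
  Finset.aemeasurable_fun_sum _ fun j _ => (hlaw j).aemeasurable

lemma memLp_of_law (hlaw : ∀ i, HasLaw (ξ i) ν μ) (h3 : MemLp id 3 ν) (i : Fin n) :
    MemLp (ξ i) 3 μ := by
  have h := h3
  rw [← (hlaw i).map_eq] at h
  exact (memLp_map_measure_iff aestronglyMeasurable_id (hlaw i).aemeasurable).1 h

lemma memLp_sum_of_law (hlaw : ∀ i, HasLaw (ξ i) ν μ) (h3 : MemLp id 3 ν) (s : Finset (Fin n)) :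
    MemLp (fun ω => ∑ j ∈ s, ξ j ω) 3 μ :=
  memLp_finsetSum s fun j _ => memLp_of_law hlaw h3 j

variable [IsProbabilityMeasure μ]

lemma isProbabilityMeasure_restLaw (hlaw : ∀ i, HasLaw (ξ i) ν μ) (i : Fin n) :
    IsProbabilityMeasure (restLaw μ ξ i) :=
  Measure.isProbabilityMeasure_map (aemeasurable_sum_of_law hlaw _)

lemma hasLaw_rest_pair (hlaw : ∀ i, HasLaw (ξ i) ν μ) (hind : iIndepFun ξ μ) (i : Fin n) :
    HasLaw (fun ω => (∑ j ∈ Finset.univ.erase i, ξ j ω, ξ i ω)) ((restLaw μ ξ i).prod ν) μ := by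
  have hs := aemeasurable_sum_of_law hlaw (Finset.univ.erase i)
  have h := hind.indepFun_finsetSum_of_notMem₀ (fun j => (hlaw j).aemeasurable)
    (Finset.notMem_erase i Finset.univ)
  have e : (∑ j ∈ Finset.univ.erase i, ξ j) = fun ω => ∑ j ∈ Finset.univ.erase i, ξ j ω := by
    funext ω; simp
  rw [e] at h
  refine ⟨hs.prodMk (hlaw i).aemeasurable, ?_⟩
  rw [(indepFun_iff_map_prod_eq_prod_map_map hs (hlaw i).aemeasurable).1 h, (hlaw i).map_eq]
  rfl

lemma integral_rest_pair (hlaw : ∀ i, HasLaw (ξ i) ν μ) (hind : iIndepFun ξ μ) (i : Fin n)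
    {Φ : ℝ × ℝ → ℝ} (hΦ : Measurable Φ) :
    ∫ ω, Φ (∑ j ∈ Finset.univ.erase i, ξ j ω, ξ i ω) ∂μ = ∫ p, Φ p ∂((restLaw μ ξ i).prod ν) :=
  (hasLaw_rest_pair hlaw hind i).integral_comp hΦ.aestronglyMeasurable

lemma integral_sq_sum (hlaw : ∀ i, HasLaw (ξ i) ν μ) (hind : iIndepFun ξ μ) (h3 : MemLp id 3 ν)
    (h0 : ∫ x, x ∂ν = 0) (s : Finset (Fin n)) :
    ∫ ω, (∑ j ∈ s, ξ j ω) ^ 2 ∂μ = s.card * ∫ x, x ^ 2 ∂ν := by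
  have hL2 : ∀ i, MemLp (ξ i) 2 μ := fun i =>
    (memLp_of_law hlaw h3 i).mono_exponent (by norm_num)
  have hmean : ∀ i, ∫ ω, ξ i ω ∂μ = 0 := fun i =>
    ((hlaw i).integral_comp (f := id) aestronglyMeasurable_id).trans h0
  have hv := IndepFun.variance_sum (X := ξ) (s := s) (fun i _ => hL2 i)
    fun i _ j _ hij => hind.indepFun hij
  have hvi : ∀ i, Var[ξ i; μ] = ∫ x, x ^ 2 ∂ν := fun i => by
    rw [variance_of_integral_eq_zero (hlaw i).aemeasurable (hmean i)]
    exact (hlaw i).integral_comp (f := fun x => x ^ 2) (by fun_prop)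
  have e : (∑ j ∈ s, ξ j) = fun ω => ∑ j ∈ s, ξ j ω := by
    funext ω; simp
  rw [e, variance_of_integral_eq_zero (aemeasurable_sum_of_law hlaw s)] at hv
  · rw [hv]; simp [hvi]
  · rw [integral_finsetSum _ fun i _ => (hL2 i).integrable (by norm_num)]
    simp [hmean]

lemma integral_abs_rest_le (hlaw : ∀ i, HasLaw (ξ i) ν μ) (hind : iIndepFun ξ μ)
    (h3 : MemLp id 3 ν) (h0 : ∫ x, x ∂ν = 0) (h2 : n * ∫ x, x ^ 2 ∂ν ≤ 1) (i : Fin n) :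
    ∫ w, |w| ∂(restLaw μ ξ i) ≤ 1 := by
  have hs := aemeasurable_sum_of_law hlaw (Finset.univ.erase i)
  have hL := memLp_sum_of_law hlaw h3 (Finset.univ.erase i)
  rw [restLaw, integral_map hs (by fun_prop)]
  have hsq := integral_sq_sum hlaw hind h3 h0 (Finset.univ.erase i)
  have hpt : ∀ ω, |∑ j ∈ Finset.univ.erase i, ξ j ω|
      ≤ (1 + (∑ j ∈ Finset.univ.erase i, ξ j ω) ^ 2) / 2 := fun ω => by
    rw [← sq_abs (∑ j ∈ Finset.univ.erase i, ξ j ω)]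
    nlinarith [sq_nonneg (|∑ j ∈ Finset.univ.erase i, ξ j ω| - 1)]
  have hi2 : Integrable (fun ω => (∑ j ∈ Finset.univ.erase i, ξ j ω) ^ 2) μ :=
    (hL.mono_exponent (p := 2) (by norm_num)).integrable_sq
  refine (integral_mono (hL.integrable (by norm_num)).abs
    (((integrable_const 1).add hi2).div_const 2) hpt).trans ?_
  rw [integral_div]
  simp only [Pi.add_apply]
  rw [integral_add (integrable_const _) hi2, hsq]
  have hc : ((Finset.univ.erase i).card : ℝ) ≤ n := by
    have := Finset.card_le_univ (Finset.univ.erase i)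
    simp only [Fintype.card_fin] at this
    exact_mod_cast this
  have hpos : 0 ≤ ∫ x, x ^ 2 ∂ν := integral_nonneg fun x => sq_nonneg x
  have := mul_le_mul_of_nonneg_right hc hpos
  simp only [integral_const, probReal_univ, one_smul]
  linarith

lemma integral_comp_sum (hlaw : ∀ i, HasLaw (ξ i) ν μ) (hind : iIndepFun ξ μ) (i : Fin n)
    {g : ℝ → ℝ} (hg : Measurable g) :
    ∫ p, g (p.1 + p.2) ∂((restLaw μ ξ i).prod ν) = ∫ ω, g (∑ j, ξ j ω) ∂μ := by
  rw [← integral_rest_pair hlaw hind i (Φ := fun p => g (p.1 + p.2)) (by fun_prop)]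
  congr 1
  funext ω
  rw [Finset.sum_erase_add _ _ (Finset.mem_univ i)]

variable [IsProbabilityMeasure ν]

/-- Leave-one-out expansion of `E[W g(W)]` for the sum `W` of centred independent variables and
a bounded function `g`. -/
lemma integral_sum_mul (hlaw : ∀ i, HasLaw (ξ i) ν μ) (hind : iIndepFun ξ μ)
    (h3 : MemLp id 3 ν) (h0 : ∫ x, x ∂ν = 0) {g : ℝ → ℝ} (hg : Measurable g) {C : ℝ}
    (hC : ∀ x, |g x| ≤ C) :
    ∫ ω, (∑ j, ξ j ω) * g (∑ j, ξ j ω) ∂μ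
      = ∑ i, ∫ p, p.2 * (g (p.1 + p.2) - g p.1) ∂((restLaw μ ξ i).prod ν) := by
  have hgW : AEMeasurable (fun ω => g (∑ j, ξ j ω)) μ :=
    hg.comp_aemeasurable (aemeasurable_sum_of_law hlaw Finset.univ)
  have hi : ∀ i, Integrable (fun ω => ξ i ω * g (∑ j, ξ j ω)) μ := fun i =>
    ((memLp_of_law hlaw h3 i).integrable (by norm_num)).mul_bdd (c := C)
      hgW.aestronglyMeasurable (ae_of_all _ fun ω => hC _)
  simp_rw [Finset.sum_mul]
  rw [integral_finsetSum _ fun i _ => hi i]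
  refine Finset.sum_congr rfl fun i _ => ?_
  have := isProbabilityMeasure_restLaw hlaw i
  have i1 := integrable_id_of_memLp h3
  have hsnd : Integrable (fun p : ℝ × ℝ => p.2) ((restLaw μ ξ i).prod ν) := i1.comp_snd _
  have e : ∫ ω, ξ i ω * g (∑ j, ξ j ω) ∂μ
      = ∫ p, p.2 * g (p.1 + p.2) ∂((restLaw μ ξ i).prod ν) := by
    rw [← integral_rest_pair hlaw hind i (Φ := fun p => p.2 * g (p.1 + p.2)) (by fun_prop)]
    congr 1
    funext ω
    rw [Finset.sum_erase_add _ _ (Finset.mem_univ i)]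
  have hz : ∫ p, p.2 * g p.1 ∂((restLaw μ ξ i).prod ν) = 0 := by
    have := integral_prod_mul (μ := restLaw μ ξ i) (ν := ν) g (fun x => x)
    simp_rw [mul_comm (g _)] at this
    rw [this, h0, mul_zero]
  simp_rw [mul_sub]
  rw [integral_sub, hz, sub_zero, e]
  · exact hsnd.mul_bdd (c := C) (hg.comp (by fun_prop)).aestronglyMeasurable
      (ae_of_all _ fun p => hC _)
  · exact hsnd.mul_bdd (c := C) (hg.comp (by fun_prop)).aestronglyMeasurable
      (ae_of_all _ fun p => hC _)

end Sums

/-! ### Concentration of the leave-one-out sums near `±q` -/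

/-- The clamp of `w - a` to `[0, ℓ]`. -/
noncomputable def ramp (a ℓ w : ℝ) : ℝ := max 0 (min (w - a) ℓ)

/-- The odd function with slope `1` on `a ≤ |w| ≤ a + ℓ` and slope `0` elsewhere. -/
noncomputable def oddRamp (a ℓ w : ℝ) : ℝ := ramp a ℓ w - ramp a ℓ (-w)

lemma ramp_nonneg (a ℓ w : ℝ) : 0 ≤ ramp a ℓ w := le_max_left _ _

lemma ramp_le {a ℓ : ℝ} (hℓ : 0 ≤ ℓ) (w : ℝ) : ramp a ℓ w ≤ ℓ :=
  max_le hℓ (min_le_right _ _)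

lemma monotone_ramp (a ℓ : ℝ) : Monotone (ramp a ℓ) := fun x y h => by
  unfold ramp; gcongr

lemma continuous_oddRamp (a ℓ : ℝ) : Continuous (oddRamp a ℓ) := by
  unfold oddRamp ramp; fun_prop

lemma abs_oddRamp_le {a ℓ : ℝ} (hℓ : 0 ≤ ℓ) (w : ℝ) : |oddRamp a ℓ w| ≤ ℓ := by
  have h1 := ramp_nonneg a ℓ w
  have h2 := ramp_nonneg a ℓ (-w)
  have h3 := ramp_le (a := a) hℓ w
  have h4 := ramp_le (a := a) hℓ (-w)
  unfold oddRamp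
  rw [abs_le]
  constructor <;> linarith

lemma oddRamp_neg (a ℓ w : ℝ) : oddRamp a ℓ (-w) = -oddRamp a ℓ w := by
  unfold oddRamp; rw [neg_neg]; ring

lemma mul_oddRamp_le {a c ℓ : ℝ} (hc : 0 < c) (hca : c ≤ a) (hℓ : 0 ≤ ℓ) (w : ℝ) :
    w * oddRamp a ℓ w ≤ ℓ / c * w ^ 2 := by
  have key : ∀ w, 0 ≤ w → w * oddRamp a ℓ w ≤ ℓ / c * w ^ 2 := by
    intro w hw
    have h2 := ramp_nonneg a ℓ (-w)
    rcases le_total w a with h | h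
    · have h1 : ramp a ℓ w = 0 := by
        unfold ramp
        exact max_eq_left ((min_le_left _ _).trans (by linarith))
      have h3 : w * oddRamp a ℓ w ≤ 0 := by
        unfold oddRamp; nlinarith
      exact h3.trans (by positivity)
    · have h1 : oddRamp a ℓ w ≤ ℓ := by
        unfold oddRamp; linarith [ramp_le (a := a) hℓ w]
      calc w * oddRamp a ℓ w ≤ w * ℓ := by gcongr
        _ = ℓ / c * (c * w) := by field_simp
        _ ≤ ℓ / c * (w * w) := by gcongr; linarith
        _ = _ := by ring
  rcases le_total 0 w with h | h
  · exact key w h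
  · have := key (-w) (by linarith)
    rw [oddRamp_neg] at this
    simpa using this

/-- If `w` lies in the ramp at distance at least `δ` from its ends, moving by `x` moves the ramp
by at least `min |x| δ`. -/
lemma le_mul_ramp_sub {a ℓ δ w x : ℝ} (hδ : 0 ≤ δ) (h1 : a + δ ≤ w) (h2 : w ≤ a + ℓ - δ) :
    |x| * min |x| δ ≤ x * (ramp a ℓ (w + x) - ramp a ℓ w) := by
  have e : ramp a ℓ w = w - a := by
    unfold ramp
    rw [min_eq_left (by linarith), max_eq_right (by linarith)]
  rw [e]
  rcases le_total 0 x with hx | hx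
  · rw [abs_of_nonneg hx]
    refine mul_le_mul_of_nonneg_left ?_ hx
    have : min (w + x - a) ℓ ≤ ramp a ℓ (w + x) := le_max_right _ _
    rcases le_total (w + x - a) ℓ with h | h
    · rw [min_eq_left h] at this
      linarith [min_le_left x δ]
    · rw [min_eq_right h] at this
      linarith [min_le_right x δ]
  · rw [abs_of_nonpos hx]
    have : ramp a ℓ (w + x) ≤ max 0 (w + x - a) := by
      unfold ramp; gcongr; exact min_le_left _ _
    have h3 : min (-x) δ ≤ w - a - ramp a ℓ (w + x) := by
      rcases le_total 0 (w + x - a) with h | h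
      · rw [max_eq_right h] at this
        linarith [min_le_left (-x) δ]
      · rw [max_eq_left h] at this
        linarith [min_le_right (-x) δ]
    nlinarith

lemma mul_oddRamp_sub_nonneg (a ℓ w x : ℝ) :
    0 ≤ x * (oddRamp a ℓ (w + x) - oddRamp a ℓ w) := by
  have hm : Monotone (oddRamp a ℓ) := fun u v h => by
    unfold oddRamp
    have h1 := monotone_ramp a ℓ h
    have h2 := monotone_ramp a ℓ (neg_le_neg h)
    linarith
  rcases le_total 0 x with hx | hx
  · exact mul_nonneg hx (sub_nonneg.2 (hm (by linarith)))
  · exact mul_nonneg_of_nonpos_of_nonpos hx (sub_nonpos.2 (hm (by linarith)))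

lemma nearInd_mul_le {q L δ : ℝ} (hδ : 0 ≤ δ) (w x : ℝ) :
    nearInd q L w * (|x| * min |x| δ)
      ≤ x * (oddRamp (q - L - δ) (2 * L + 2 * δ) (w + x)
          - oddRamp (q - L - δ) (2 * L + 2 * δ) w) := by
  set a := q - L - δ with ha
  set ℓ := 2 * L + 2 * δ with hℓ
  by_cases h : |(|w| - q)| ≤ L
  · -- By oddness one may assume `w ≥ 0`.
    have key : ∀ w x, 0 ≤ w → |(|w| - q)| ≤ L →
        |x| * min |x| δ ≤ x * (oddRamp a ℓ (w + x) - oddRamp a ℓ w) := by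
      intro w x hw h
      rw [abs_of_nonneg hw, abs_le] at h
      have h1 := le_mul_ramp_sub (a := a) (ℓ := ℓ) (x := x) hδ
        (show a + δ ≤ w by rw [ha]; linarith) (by rw [ha, hℓ]; linarith)
      have h2 : 0 ≤ x * (ramp a ℓ (-w) - ramp a ℓ (-(w + x))) := by
        rcases le_total 0 x with hx | hx
        · exact mul_nonneg hx (sub_nonneg.2 (monotone_ramp a ℓ (by linarith)))
        · exact mul_nonneg_of_nonpos_of_nonpos hx
            (sub_nonpos.2 (monotone_ramp a ℓ (by linarith)))
      unfold oddRamp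
      linarith
    rw [nearInd, if_pos h, one_mul]
    rcases le_total 0 w with hw | hw
    · exact key w x hw h
    · have := key (-w) (-x) (by linarith) (by rwa [abs_neg])
      rw [← neg_add, oddRamp_neg, oddRamp_neg, abs_neg] at this
      linarith
  · rw [nearInd, if_neg h, zero_mul]
    exact mul_oddRamp_sub_nonneg a ℓ w x

section Concentration

variable {Ω : Type*} [MeasurableSpace Ω] {μ : Measure Ω} [IsProbabilityMeasure μ] {n : ℕ}
  {ξ : Fin n → Ω → ℝ} {ν : Measure ℝ} [IsProbabilityMeasure ν]

lemma integrable_nearInd {m : Measure ℝ} [IsProbabilityMeasure m] (q L : ℝ) :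
    Integrable (nearInd q L) m := by
  refine (integrable_const (1 : ℝ)).mono' ?_ (ae_of_all _ fun w => ?_)
  · exact ((measurable_nearInd q).comp
      (measurable_const.prodMk measurable_id : Measurable fun w : ℝ => (L, w))).aestronglyMeasurable
  · rw [Real.norm_eq_abs, abs_of_nonneg (nearInd_nonneg _ _ _)]
    exact nearInd_le_one _ _ _

lemma integrable_mul_min (h3 : MemLp id 3 ν) {δ : ℝ} (hδ : 0 ≤ δ) :
    Integrable (fun x => |x| * min |x| δ) ν := by
  refine (integrable_id_of_memLp h3).abs.mul_bdd (c := δ) (by fun_prop) (ae_of_all _ fun x => ?_)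
  rw [Real.norm_eq_abs, abs_of_nonneg (le_min (abs_nonneg x) hδ)]
  exact min_le_right _ _

/-- With `δ` equal to half the ratio of the third to the second moment, truncation at `δ` keeps
half of the variance. -/
lemma half_sq_le_integral_mul_min (h3 : MemLp id 3 ν) {δ : ℝ} (hδ : 0 < δ)
    (h : ∫ x, |x| ^ 3 ∂ν = 2 * δ * ∫ x, x ^ 2 ∂ν) :
    (∫ x, x ^ 2 ∂ν) / 2 ≤ ∫ x, |x| * min |x| δ ∂ν := by
  have hpt : ∀ x : ℝ, x ^ 2 - |x| ^ 3 / (4 * δ) ≤ |x| * min |x| δ := by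
    intro x
    rw [← sq_abs x]
    have hx := abs_nonneg x
    set y := |x|
    rcases le_total y δ with h | h
    · rw [min_eq_left h]
      have : 0 ≤ y ^ 3 / (4 * δ) := by positivity
      nlinarith
    · rw [min_eq_right h]
      have : y ^ 2 - y * δ ≤ y ^ 3 / (4 * δ) := by
        rw [le_div_iff₀ (by positivity)]
        nlinarith [mul_nonneg hx (sq_nonneg (y - 2 * δ))]
      linarith
  have i2 := integrable_sq_of_memLp h3
  have i3 := integrable_cube_of_memLp h3
  have := integral_mono (i2.sub (i3.div_const (4 * δ))) (integrable_mul_min h3 hδ.le) hpt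
  simp only [Pi.sub_apply] at this
  rw [integral_sub i2 (i3.div_const _), integral_div, h] at this
  refine le_trans (le_of_eq ?_) this
  field_simp
  ring

/-- Concentration near `±q`: on average over `i`, the sum without the `i`-th variable is within
`L` of `±q` with probability at most `10 L + 9 δ`. -/
lemma sum_integral_nearInd_le (hlaw : ∀ i, HasLaw (ξ i) ν μ) (hind : iIndepFun ξ μ)
    (h3 : MemLp id 3 ν) (h0 : ∫ x, x ∂ν = 0) {q δ L : ℝ} (hq : 3 / 5 ≤ q) (hδ : 0 < δ)
    (hδ' : δ ≤ 1 / 20) (hL : 0 ≤ L) (h2 : 0 < ∫ x, x ^ 2 ∂ν)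
    (h : ∫ x, |x| ^ 3 ∂ν = 2 * δ * ∫ x, x ^ 2 ∂ν) :
    ∑ i, ∫ w, nearInd q L w ∂(restLaw μ ξ i) ≤ n * (10 * L + 9 * δ) := by
  have hp := isProbabilityMeasure_restLaw (μ := μ) (ξ := ξ) hlaw
  -- For `L > 1/10` the bound exceeds `1`; otherwise the ramp stays above `9/20`.
  rcases lt_or_ge (1 / 10) L with hL1 | hL1
  · have : ∀ i, ∫ w, nearInd q L w ∂(restLaw μ ξ i) ≤ 10 * L + 9 * δ := by
      intro i
      refine (integral_mono (integrable_nearInd q L) (integrable_const 1)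
        (nearInd_le_one q L)).trans ?_
      simp only [integral_const, probReal_univ, one_smul]
      linarith
    refine (Finset.sum_le_sum fun i _ => this i).trans ?_
    simp only [Finset.sum_const, Finset.card_univ, Fintype.card_fin, nsmul_eq_mul, le_refl]
  set a := q - L - δ with ha
  set ℓ := 2 * L + 2 * δ with hℓ
  have hℓ0 : 0 ≤ ℓ := by positivity
  have ha0 : 9 / 20 ≤ a := by rw [ha]; linarith
  set s2 := ∫ x, x ^ 2 ∂ν with hs2
  have hexp := integral_sum_mul hlaw hind h3 h0 (continuous_oddRamp a ℓ).measurable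
    (abs_oddRamp_le hℓ0)
  have hW := memLp_sum_of_law hlaw h3 Finset.univ
  have hup : ∫ ω, (∑ j, ξ j ω) * oddRamp a ℓ (∑ j, ξ j ω) ∂μ ≤ ℓ / (9 / 20) * (n * s2) := by
    have hsq := integral_sq_sum hlaw hind h3 h0 Finset.univ
    rw [Finset.card_univ, Fintype.card_fin] at hsq
    rw [hs2, ← hsq, ← integral_const_mul]
    refine integral_mono ?_
      ((hW.mono_exponent (p := 2) (by norm_num)).integrable_sq.const_mul _)
      fun ω => mul_oddRamp_le (by norm_num) ha0 hℓ0 _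
    exact (hW.integrable (by norm_num)).mul_bdd (c := ℓ)
      ((continuous_oddRamp a ℓ).measurable.comp_aemeasurable
        (aemeasurable_sum_of_law hlaw Finset.univ)).aestronglyMeasurable
      (ae_of_all _ fun ω => abs_oddRamp_le hℓ0 _)
  set β := ∫ x, |x| * min |x| δ ∂ν with hβ
  have hlow : (∑ i, ∫ w, nearInd q L w ∂(restLaw μ ξ i)) * β
      ≤ ∫ ω, (∑ j, ξ j ω) * oddRamp a ℓ (∑ j, ξ j ω) ∂μ := by
    rw [hexp, Finset.sum_mul]
    refine Finset.sum_le_sum fun i _ => ?_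
    rw [hβ, ← integral_prod_mul]
    have hc := continuous_oddRamp a ℓ
    have hsnd : Integrable (fun p : ℝ × ℝ => p.2) ((restLaw μ ξ i).prod ν) :=
      (integrable_id_of_memLp h3).comp_snd _
    refine integral_mono ((integrable_nearInd q L).mul_prod (integrable_mul_min h3 hδ.le)) ?_
      fun p => nearInd_mul_le hδ.le p.1 p.2
    refine hsnd.mul_bdd (c := 2 * ℓ) (by fun_prop) (ae_of_all _ fun p => ?_)
    refine (abs_sub _ _).trans ?_
    linarith [abs_oddRamp_le (a := a) hℓ0 (p.1 + p.2), abs_oddRamp_le (a := a) hℓ0 p.1]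
  have hβ2 := half_sq_le_integral_mul_min h3 hδ h
  have hS : 0 ≤ ∑ i, ∫ w, nearInd q L w ∂(restLaw μ ξ i) :=
    Finset.sum_nonneg fun i _ => integral_nonneg fun w => nearInd_nonneg _ _ _
  set S := ∑ i, ∫ w, nearInd q L w ∂(restLaw μ ξ i)
  have h5 : S * (s2 / 2) ≤ ℓ / (9 / 20) * (n * s2) :=
    (mul_le_mul_of_nonneg_left hβ2 hS).trans (hlow.trans hup)
  have h6 : S ≤ n * (ℓ * (40 / 9)) := by
    have h7 : S * s2 ≤ (n * (ℓ * (40 / 9))) * s2 := by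
      linarith
    exact le_of_mul_le_mul_right h7 h2
  refine h6.trans ?_
  gcongr
  rw [hℓ]
  linarith

/-! ### A Berry–Esseen bound for the two-sided tail -/

/-- A Berry–Esseen bound for the two-sided tail at `q ≥ 3/5`. The variance `n E[ξ²]` of the sum is
only required to be at most `1`; the error does not deteriorate when it is small. -/
theorem measureReal_lt_abs_sum_le (hlaw : ∀ i, HasLaw (ξ i) ν μ) (hind : iIndepFun ξ μ)
    (h3 : MemLp id 3 ν) (h0 : ∫ x, x ∂ν = 0) (h2 : n * ∫ x, x ^ 2 ∂ν ≤ 1) {q : ℝ}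
    (hq : 3 / 5 ≤ q) (hT : normalTail q ≤ 1 / 2) :
    μ.real {ω | q < |∑ i, ξ i ω|} ≤ normalTail q + 227 * (n * ∫ x, |x| ^ 3 ∂ν) := by
  have hq0 : 0 < q := by linarith
  have hT0 := normalTail_pos q
  have hp := isProbabilityMeasure_restLaw (μ := μ) (ξ := ξ) hlaw
  set s2 := ∫ x, x ^ 2 ∂ν with hs2
  set s3 := ∫ x, |x| ^ 3 ∂ν with hs3
  set T := normalTail q
  have hs2n : 0 ≤ s2 := integral_nonneg fun x => sq_nonneg x
  have hs3n : 0 ≤ s3 := integral_nonneg fun x => by positivity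
  set W : Ω → ℝ := fun ω => ∑ j, ξ j ω with hWdef
  have hWm : AEMeasurable W μ := aemeasurable_sum_of_law hlaw Finset.univ
  have hWL : MemLp W 3 μ := memLp_sum_of_law hlaw h3 Finset.univ
  have hWsq : ∫ ω, W ω ^ 2 ∂μ = n * s2 := by
    have := integral_sq_sum hlaw hind h3 h0 Finset.univ
    rwa [Finset.card_univ, Fintype.card_fin] at this
  have hW2i : Integrable (fun ω => W ω ^ 2) μ :=
    (hWL.mono_exponent (p := 2) (by norm_num)).integrable_sq
  have htm := measurable_tailInd q
  have hti : Integrable (fun ω => tailInd q (W ω)) μ := by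
    refine (integrable_const (1 : ℝ)).mono' (htm.comp_aemeasurable hWm).aestronglyMeasurable
      (ae_of_all _ fun ω => ?_)
    unfold tailInd; split_ifs <;> simp
  have hp_eq : μ.real {ω | q < |W ω|} = ∫ ω, tailInd q (W ω) ∂μ := by
    have hns : NullMeasurableSet {ω | q < |W ω|} μ :=
      nullMeasurableSet_lt aemeasurable_const hWm.abs
    have e : (fun ω => tailInd q (W ω)) = {ω | q < |W ω|}.indicator fun _ => 1 := by
      funext ω
      simp [tailInd, Set.indicator]
    rw [e, integral_indicator₀ hns]
    simp
  set p := μ.real {ω | q < |W ω|} with hpdef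
  rcases le_or_gt (n * s2) (10 * (n * s3)) with hsmall | hbig
  · -- Small variance: Chebyshev's inequality.
    have hpt : ∀ ω, tailInd q (W ω) ≤ W ω ^ 2 * (25 / 9) := by
      intro ω
      unfold tailInd
      split_ifs with h
      · have : 3 / 5 < |W ω| := by linarith
        rw [← sq_abs]; nlinarith
      · positivity
    have h5 := integral_mono hti (hW2i.mul_const _) hpt
    rw [integral_mul_const, hWsq, ← hp_eq] at h5
    have : 0 ≤ n * s3 := by positivity
    linarith
  have hn : (0 : ℝ) < n := by
    rcases Nat.eq_zero_or_pos n with h | h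
    · exfalso
      rw [h] at hbig
      simp at hbig
    · exact_mod_cast h
  have hs23 : 10 * s3 < s2 := by
    by_contra! hc
    have := mul_le_mul_of_nonneg_left hc hn.le
    linarith
  have hs2p : 0 < s2 := by linarith
  have hs3p : 0 < s3 := by
    refine hs3n.lt_of_ne fun hc => ?_
    have hz := (integral_eq_zero_iff_of_nonneg (fun x => by positivity)
      (integrable_cube_of_memLp h3)).1 hc.symm
    have : s2 = 0 := by
      rw [hs2]
      refine integral_eq_zero_of_ae ?_
      filter_upwards [hz] with x hx
      simpa using hx
    linarith
  -- Truncation at this level keeps half of the variance, and `δ` times the variance is of the order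
  -- of the third moment, so the concentration error below stays proportional to `n s3`.
  set δ := s3 / (2 * s2) with hδdef
  have hδ : 0 < δ := by positivity
  have hδ' : δ ≤ 1 / 20 := by
    rw [hδdef, div_le_div_iff₀ (by positivity) (by norm_num)]
    linarith
  have hδs : s3 = 2 * δ * s2 := by rw [hδdef]; field_simp
  -- The error of the Stein equation.
  have herr : |∫ ω, W ω * steinSol q (W ω) ∂μ - n * s2 * ∫ ω, steinDeriv q (W ω) ∂μ|
      ≤ 30 * (n * s3) := by
    have hexp := integral_sum_mul hlaw hind h3 h0 (continuous_steinSol q).measurable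
      (abs_steinSol_le hq0)
    have e2 : n * s2 * ∫ ω, steinDeriv q (W ω) ∂μ
        = ∑ i, s2 * ∫ p, steinDeriv q (p.1 + p.2) ∂((restLaw μ ξ i).prod ν) := by
      simp_rw [integral_comp_sum hlaw hind _ (measurable_steinDeriv q)]
      simp only [Finset.sum_const, Finset.card_univ, Fintype.card_fin, nsmul_eq_mul]
      ring
    rw [hexp, e2, ← Finset.sum_sub_distrib]
    have hmi : ∀ i, Integrable (fun w => w) (restLaw μ ξ i) := fun i =>
      (integrable_map_measure (g := fun w => w) (by fun_prop)
        (aemeasurable_sum_of_law hlaw _)).2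
        ((memLp_sum_of_law hlaw h3 _).integrable (by norm_num))
    refine (Finset.abs_sum_le_sum_abs _ _).trans
      ((Finset.sum_le_sum fun i _ => abs_stein_step_le hq0 (hmi i) h3).trans ?_)
    rw [Finset.sum_add_distrib]
    have hA : ∑ i, (∫ w, |w| ∂(restLaw μ ξ i) + 1 / q) * (2 * s3) ≤ n * ((8 / 3) * (2 * s3)) := by
      have : ∀ i, (∫ w, |w| ∂(restLaw μ ξ i) + 1 / q) * (2 * s3) ≤ (8 / 3) * (2 * s3) := by
        intro i
        have h1 := integral_abs_rest_le hlaw hind h3 h0 h2 i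
        have h4 : 1 / q ≤ 5 / 3 := by
          rw [div_le_div_iff₀ hq0 (by norm_num)]; linarith
        gcongr
        linarith
      refine (Finset.sum_le_sum fun i _ => this i).trans ?_
      simp
    have i1 := integrable_id_of_memLp h3
    have i2 := integrable_sq_of_memLp h3
    have i3 := integrable_cube_of_memLp h3
    have hmn := measurable_nearInd q
    have hB : ∑ i, ∫ z, z.1 ^ 2 * ∫ w, nearInd q (|z.1| + |z.2|) w ∂(restLaw μ ξ i) ∂(ν.prod ν)
        ≤ n * (20 * s3 + 9 * δ * s2) := by
      rw [← integral_finsetSum]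
      · have hpt : ∀ z : ℝ × ℝ,
            ∑ i, z.1 ^ 2 * ∫ w, nearInd q (|z.1| + |z.2|) w ∂(restLaw μ ξ i)
            ≤ n * ((50 / 3) * |z.1| ^ 3 + (10 / 3) * |z.2| ^ 3 + 9 * δ * z.1 ^ 2) := by
          intro z
          rw [← Finset.mul_sum]
          have h1 := sum_integral_nearInd_le hlaw hind h3 h0 hq hδ hδ'
            (add_nonneg (abs_nonneg z.1) (abs_nonneg z.2)) hs2p hδs
          refine (mul_le_mul_of_nonneg_left h1 (sq_nonneg z.1)).trans ?_
          have := mul_le_mul_of_nonneg_left (sq_mul_abs_add_abs_le z.1 z.2) hn.le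
          linarith
        have j1 : Integrable (fun z : ℝ × ℝ => (50 / 3) * |z.1| ^ 3) (ν.prod ν) :=
          (i3.comp_fst ν).const_mul _
        have j2 : Integrable (fun z : ℝ × ℝ => (10 / 3) * |z.2| ^ 3) (ν.prod ν) :=
          (i3.comp_snd ν).const_mul _
        have j3 : Integrable (fun z : ℝ × ℝ => 9 * δ * z.1 ^ 2) (ν.prod ν) :=
          (i2.comp_fst ν).const_mul _
        have j12 : Integrable (fun z : ℝ × ℝ => (50 / 3) * |z.1| ^ 3 + (10 / 3) * |z.2| ^ 3)
            (ν.prod ν) := j1.add j2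
        refine (integral_mono_of_nonneg (ae_of_all _ fun z => ?_)
          ((j12.add j3).const_mul (n : ℝ)) (ae_of_all _ hpt)).trans (le_of_eq ?_)
        · exact Finset.sum_nonneg fun i _ => mul_nonneg (sq_nonneg _)
            (integral_nonneg fun w => nearInd_nonneg _ _ _)
        · simp only [Pi.add_apply]
          rw [integral_const_mul, integral_add j12 j3, integral_add j1 j2,
            integral_const_mul, integral_const_mul, integral_const_mul,
            integral_fun_fst (fun x : ℝ => |x| ^ 3), integral_fun_snd (fun x : ℝ => |x| ^ 3),
            integral_fun_fst (fun x : ℝ => x ^ 2)]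
          simp only [probReal_univ, one_smul]
          ring
      · intro i _
        have hb : Integrable (fun z : ℝ × ℝ => z.1 ^ 2) (ν.prod ν) := i2.comp_fst ν
        refine hb.mul_bdd (c := 1) ?_ (ae_of_all _ fun z => ?_)
        · have hm' : Measurable fun p : (ℝ × ℝ) × ℝ => nearInd q (|p.1.1| + |p.1.2|) p.2 :=
            hmn.comp (f := fun p : (ℝ × ℝ) × ℝ => (|p.1.1| + |p.1.2|, p.2)) (by fun_prop)
          exact (hm'.stronglyMeasurable.integral_prod_right).aestronglyMeasurable
        · rw [Real.norm_eq_abs, abs_of_nonneg (integral_nonneg fun w => nearInd_nonneg _ _ _)]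
          refine (integral_mono (integrable_nearInd _ _) (integrable_const 1)
            (nearInd_le_one _ _)).trans ?_
          simp
    refine (add_le_add hA hB).trans ?_
    have e : δ * s2 = s3 / 2 := by linarith
    have h9 : 9 * δ * s2 = 9 * s3 / 2 := by linarith
    rw [h9]
    have : 0 ≤ n * s3 := by positivity
    linarith
  -- The Stein equation and the sign of the Stein derivative.
  have hdm := measurable_steinDeriv q
  have hdi : Integrable (fun ω => steinDeriv q (W ω)) μ :=
    (integrable_const (1 : ℝ)).mono' (hdm.comp_aemeasurable hWm).aestronglyMeasurable
      (ae_of_all _ fun ω => abs_steinDeriv_le hq0 _)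
  have hfi : Integrable (fun ω => W ω * steinSol q (W ω)) μ :=
    (hWL.integrable (by norm_num)).mul_bdd (c := 1 / q)
      ((continuous_steinSol q).measurable.comp_aemeasurable hWm).aestronglyMeasurable
      (ae_of_all _ fun ω => abs_steinSol_le hq0 _)
  have hstein : ∫ ω, steinDeriv q (W ω) ∂μ = ∫ ω, W ω * steinSol q (W ω) ∂μ + p - T := by
    have : (fun ω => steinDeriv q (W ω))
        = fun ω => W ω * steinSol q (W ω) + tailInd q (W ω) - T := rfl
    have hfti : Integrable (fun ω => W ω * steinSol q (W ω) + tailInd q (W ω)) μ := hfi.add hti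
    rw [this, integral_sub hfti (integrable_const _), integral_add hfi hti, hp_eq]
    simp
  -- `9/34` is the value at `q = 3/5` of the Mills bound `q² / (1 + q²)`.
  set r := (1 - T) * (9 / 34) with hr
  have hdle : ∫ ω, steinDeriv q (W ω) ∂μ ≤ p * (1 - r) - T := by
    have hpt : ∀ ω, steinDeriv q (W ω) ≤ tailInd q (W ω) * (1 - r) - T := by
      intro ω
      unfold tailInd
      split_ifs with h
      · have h1 := (steinDeriv_mem_of_lt_abs hq0 h).2
        have h4 : 9 / 34 ≤ q ^ 2 / (1 + q ^ 2) := by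
          rw [div_le_div_iff₀ (by norm_num) (by positivity)]
          nlinarith
        have h5 := mul_le_mul_of_nonneg_left h4 (show 0 ≤ 1 - T by linarith)
        have : steinDeriv q (W ω) ≤ (1 - T) * (1 - q ^ 2 / (1 + q ^ 2)) := h1
        rw [hr]
        linarith
      · have := (steinDeriv_mem_of_abs_le hq0 (not_lt.1 h)).2
        simpa using this
    refine (integral_mono hdi ((hti.mul_const _).sub (integrable_const _)) hpt).trans
      (le_of_eq ?_)
    simp only [Pi.sub_apply]
    rw [integral_sub (hti.mul_const _) (integrable_const _), integral_mul_const, hp_eq]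
    simp only [integral_const, probReal_univ, one_smul, T]
  set D := ∫ ω, steinDeriv q (W ω) ∂μ
  have hns : 0 ≤ n * s2 := by positivity
  have hγ : 0 ≤ n * s3 := by positivity
  have h6 := (abs_le.1 herr).1
  have h7 := mul_le_mul_of_nonneg_left hdle (sub_nonneg.2 h2)
  set k := 1 - n * s2 with hk
  have hk0 : 0 ≤ k := by rw [hk]; linarith
  have hk1 : k ≤ 1 := by rw [hk]; linarith
  have h8 : p - T ≤ k * (p * (1 - r) - T) + 30 * (n * s3) := by
    have : p - T = k * D + (n * s2 * D - ∫ ω, W ω * steinSol q (W ω) ∂μ) := by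
      rw [hk, hstein]; ring
    linarith
  have hrlow : 9 / 68 ≤ r := by rw [hr]; linarith
  have hr1 : r ≤ 1 := by rw [hr]; linarith
  by_contra! hc
  have hd : 227 * (n * s3) < p - T := by linarith
  have hd0 : 0 ≤ p - T := by linarith
  -- `(1 - k) (p - T) + k r p ≤ 30 γ`, and the left side is at least `r (p - T)`.
  have h10 : r * (p - T) ≤ 30 * (n * s3) := by
    have h11 : 0 ≤ (1 - k) * ((1 - r) * (p - T)) :=
      mul_nonneg (by linarith) (mul_nonneg (by linarith) hd0)
    have h12 : 0 ≤ k * (r * T) := mul_nonneg hk0 (mul_nonneg (by linarith) hT0.le)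
    nlinarith
  have h13 := mul_le_mul_of_nonneg_right hrlow hd0
  linarith

end Concentration

/-! ### The chi quantile with one degree of freedom -/

lemma measurable_chi_norm (k : ℕ) : Measurable fun w : Fin k → ℝ => √(∑ i, w i ^ 2) := by
  fun_prop

lemma isProbabilityMeasure_chiMeasure (k : ℕ) : IsProbabilityMeasure (chiMeasure k) :=
  Measure.isProbabilityMeasure_map (measurable_chi_norm k).aemeasurable

lemma gaussianReal_real_Icc {x : ℝ} (hx : 0 ≤ x) :
    (gaussianReal 0 1).real (Icc (-x) x) = gaussInt x / gaussTotal := by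
  rw [measureReal_def, gaussianReal_apply_eq_integral 0 one_ne_zero, ENNReal.toReal_ofReal
    (setIntegral_nonneg measurableSet_Icc fun y _ => gaussianPDFReal_nonneg _ _ _),
    integral_Icc_eq_integral_Ioc, ← intervalIntegral.integral_of_le (by linarith)]
  have hpdf : ∀ y, gaussianPDFReal 0 1 y = (√(2 * Real.pi))⁻¹ * Real.exp (-y ^ 2 / 2) := by
    intro y
    simp [gaussianPDFReal]
  have hi : ∀ a b : ℝ, IntervalIntegrable (fun t : ℝ => Real.exp (-t ^ 2 / 2)) volume a b :=
    fun a b => Continuous.intervalIntegrable (by fun_prop) _ _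
  have hsplit : ∫ t in (-x)..x, Real.exp (-t ^ 2 / 2) = 2 * gaussInt x := by
    rw [← intervalIntegral.integral_add_adjacent_intervals (hi (-x) 0) (hi 0 x),
      intervalIntegral.integral_symm]
    have := gaussInt_neg x
    unfold gaussInt at this ⊢
    rw [this]
    ring
  simp_rw [hpdf]
  rw [intervalIntegral.integral_const_mul, hsplit, gaussTotal]
  have : √(2 * Real.pi) ≠ 0 := by positivity
  field_simp

lemma cdf_chiMeasure_one {x : ℝ} (hx : 0 ≤ x) :
    cdf (chiMeasure 1) x = 1 - normalTail x := by
  have := isProbabilityMeasure_chiMeasure 1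
  rw [cdf_eq_real, chiMeasure, map_measureReal_apply (measurable_chi_norm 1) measurableSet_Iic]
  have hmp := measurePreserving_eval (fun _ : Fin 1 => gaussianReal 0 1) 0
  have e : (fun w : Fin 1 → ℝ => √(∑ i, w i ^ 2)) ⁻¹' Iic x
      = Function.eval 0 ⁻¹' Icc (-x) x := by
    ext w
    simp [Real.sqrt_sq_eq_abs, abs_le]
  rw [e, hmp.measureReal_preimage measurableSet_Icc.nullMeasurableSet, gaussianReal_real_Icc hx,
    normalTail]
  ring

lemma continuous_normalTail : Continuous normalTail := by
  have := continuous_gaussInt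
  unfold normalTail
  fun_prop

lemma strictAnti_normalTail : StrictAnti normalTail := fun x y h => by
  unfold normalTail
  have h1 := strictMono_gaussInt h
  have h2 := gaussTotal_pos
  gcongr

lemma tendsto_normalTail : Tendsto normalTail atTop (𝓝 0) := by
  have h := (tendsto_gaussInt.div_const gaussTotal).const_sub 1
  rwa [div_self gaussTotal_pos.ne', sub_self] at h

/-- The median of `|N|` is at least `3/5`. -/
lemma half_le_normalTail : 1 / 2 ≤ normalTail (3 / 5) := by
  have h1 : gaussInt (3 / 5) ≤ 3 / 5 := by
    have h := intervalIntegral.norm_integral_le_of_norm_le_const (a := (0 : ℝ)) (b := 3 / 5)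
      (f := fun t => Real.exp (-t ^ 2 / 2)) (C := 1) fun t _ => by
        rw [Real.norm_eq_abs, abs_of_pos (Real.exp_pos _), Real.exp_le_one_iff]
        nlinarith [sq_nonneg t]
    have h' : |gaussInt (3 / 5)| ≤ 1 * |3 / 5 - 0| := h
    have h3 := le_abs_self (gaussInt (3 / 5))
    norm_num at h'
    linarith
  have h2 : 6 / 5 ≤ gaussTotal := by
    have h : (12 / 5 : ℝ) ≤ √(2 * Real.pi) := by
      refine Real.le_sqrt_of_sq_le ?_
      have := Real.pi_gt_three
      norm_num
      linarith
    unfold gaussTotal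
    linarith
  have h3 : gaussInt (3 / 5) / gaussTotal ≤ 1 / 2 := by
    rw [div_le_div_iff₀ gaussTotal_pos (by norm_num)]
    linarith
  unfold normalTail
  linarith

lemma chiQuantile_one_mem {p : ℝ} (hp : 1 / 2 ≤ p) (hp1 : p < 1) :
    3 / 5 ≤ chiQuantile 1 p ∧ normalTail (chiQuantile 1 p) ≤ 1 - p := by
  have hS : {x : ℝ | 0 ≤ x ∧ p ≤ cdf (chiMeasure 1) x} = {x | 0 ≤ x ∧ normalTail x ≤ 1 - p} := by
    ext x
    refine and_congr_right fun hx => ?_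
    rw [cdf_chiMeasure_one hx]
    constructor <;> intro h <;> linarith
  have hlow : ∀ x ∈ {x : ℝ | 0 ≤ x ∧ normalTail x ≤ 1 - p}, 3 / 5 ≤ x := by
    rintro x ⟨-, hx⟩
    by_contra! hc
    have := strictAnti_normalTail hc
    linarith [half_le_normalTail]
  have hne : {x : ℝ | 0 ≤ x ∧ normalTail x ≤ 1 - p}.Nonempty := by
    obtain ⟨x, hx, hx0⟩ := ((tendsto_normalTail.eventually_lt_const
      (show 0 < 1 - p by linarith)).and (eventually_ge_atTop 0)).exists
    exact ⟨x, hx0, hx.le⟩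
  have hcl : IsClosed {x : ℝ | 0 ≤ x ∧ normalTail x ≤ 1 - p} :=
    (isClosed_le continuous_const continuous_id).inter
      (isClosed_le continuous_normalTail continuous_const)
  have hmem := hcl.csInf_mem hne ⟨3 / 5, hlow⟩
  rw [chiQuantile, hS]
  exact ⟨hlow _ hmem, hmem.2⟩

/-! ### Averages of functions of a sample -/

section Sample

variable {Ω E : Type*} [MeasurableSpace Ω] [MeasurableSpace E] {μ : Measure Ω}
  {P : Measure E} {n : ℕ} {θ : Fin n → Ω → E}

lemma memLp_three_of_integrable_cube {g : E → ℝ} (hg : Measurable g)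
    (h : Integrable (fun t => |g t| ^ 3) P) : MemLp g 3 P := by
  rw [← integrable_norm_rpow_iff hg.aestronglyMeasurable (by norm_num) (by norm_num)]
  refine h.congr (ae_of_all _ fun t => ?_)
  simp only [Real.norm_eq_abs, ENNReal.toReal_ofNat]
  exact (Real.rpow_natCast |g t| 3).symm

lemma hasLaw_comp (hlaw : ∀ i, HasLaw (θ i) P μ) {g : E → ℝ} (hg : Measurable g) (i : Fin n) :
    HasLaw (fun ω => g (θ i ω)) (P.map g) μ := by
  refine ⟨hg.comp_aemeasurable (hlaw i).aemeasurable, ?_⟩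
  rw [← (hlaw i).map_eq, AEMeasurable.map_map_of_aemeasurable hg.aemeasurable
    (hlaw i).aemeasurable]
  rfl

variable [IsProbabilityMeasure μ] [IsProbabilityMeasure P]

/-- The Berry–Esseen bound for the average of `g` over a sample, on the scale `σ`. -/
lemma measureReal_lt_abs_average_le (hn : 1 ≤ n) (hlaw : ∀ i, HasLaw (θ i) P μ)
    (hind : iIndepFun θ μ) {g : E → ℝ} (hg : Measurable g)
    (h3 : Integrable (fun t => |g t| ^ 3) P) (h0 : ∫ t, g t ∂P = 0) {σ κ q : ℝ} (hσ : 0 < σ)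
    (h2 : ∫ t, g t ^ 2 ∂P ≤ σ ^ 2) (hκ : ∫ t, |g t| ^ 3 ∂P ≤ κ * σ ^ 3) (hq : 3 / 5 ≤ q)
    (hT : normalTail q ≤ 1 / 2) :
    μ.real {ω | σ * q / √n < |1 / (n : ℝ) * ∑ i, g (θ i ω)|} ≤ normalTail q + 227 * (κ / √n) := by
  have hn0 : (0 : ℝ) < n := by exact_mod_cast hn
  have hs : 0 < √(n : ℝ) := Real.sqrt_pos.2 hn0
  have hsq : √(n : ℝ) ^ 2 = n := Real.sq_sqrt hn0.le
  set c := (σ * √n)⁻¹ with hc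
  have hc0 : 0 < c := by positivity
  have hcg : Measurable fun t => c * g t := hg.const_mul c
  set ν := P.map fun t => c * g t with hν
  have : IsProbabilityMeasure ν := Measure.isProbabilityMeasure_map hcg.aemeasurable
  have hind' : iIndepFun (fun i ω => c * g (θ i ω)) μ :=
    hind.comp (fun _ t => c * g t) fun _ => hcg
  have hL : MemLp id 3 ν := by
    rw [hν, memLp_map_measure_iff aestronglyMeasurable_id hcg.aemeasurable]
    exact (memLp_three_of_integrable_cube hg h3).const_mul c
  have e1 : ∫ x, x ∂ν = 0 := by
    rw [hν, integral_map hcg.aemeasurable (by fun_prop), integral_const_mul, h0, mul_zero]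
  have e2 : ∫ x, x ^ 2 ∂ν = c ^ 2 * ∫ t, g t ^ 2 ∂P := by
    rw [hν, integral_map hcg.aemeasurable (by fun_prop), ← integral_const_mul]
    simp_rw [mul_pow]
  have e3 : ∫ x, |x| ^ 3 ∂ν = c ^ 3 * ∫ t, |g t| ^ 3 ∂P := by
    rw [hν, integral_map hcg.aemeasurable (by fun_prop), ← integral_const_mul]
    simp_rw [abs_mul, mul_pow, abs_of_pos hc0]
  have hv : n * ∫ x, x ^ 2 ∂ν ≤ 1 := by
    rw [e2]
    calc (n : ℝ) * (c ^ 2 * ∫ t, g t ^ 2 ∂P) ≤ n * (c ^ 2 * σ ^ 2) := by gcongr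
      _ = n * (√(n : ℝ) ^ 2)⁻¹ := by rw [hc]; field_simp
      _ = 1 := by rw [hsq]; field_simp
  have hbe := measureReal_lt_abs_sum_le (hasLaw_comp hlaw hcg) hind' hL e1 hv hq hT
  have hset : {ω | σ * q / √n < |1 / (n : ℝ) * ∑ i, g (θ i ω)|}
      = {ω | q < |∑ i, c * g (θ i ω)|} := by
    ext ω
    simp only [mem_ofPred_eq]
    have e : 1 / (n : ℝ) * ∑ i, g (θ i ω) = σ / √n * ∑ i, c * g (θ i ω) := by
      rw [← Finset.mul_sum, ← mul_assoc, hc]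
      congr 1
      nth_rewrite 1 [← hsq]
      field_simp
    rw [e, abs_mul, abs_of_pos (show 0 < σ / √n by positivity), mul_div_right_comm,
      mul_lt_mul_iff_right₀ (by positivity)]
  rw [hset]
  refine hbe.trans ?_
  rw [e3]
  have : n * (c ^ 3 * ∫ t, |g t| ^ 3 ∂P) ≤ κ / √n := by
    calc n * (c ^ 3 * ∫ t, |g t| ^ 3 ∂P) ≤ n * (c ^ 3 * (κ * σ ^ 3)) := by gcongr
      _ = κ / √n := by
        rw [hc]
        nth_rewrite 1 [← hsq]
        field_simp
  linarith

lemma integral_average_sq (hn : 1 ≤ n) (hlaw : ∀ i, HasLaw (θ i) P μ) (hind : iIndepFun θ μ)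
    {g : E → ℝ} (hg : Measurable g) (h3 : MemLp g 3 P) (h0 : ∫ t, g t ∂P = 0) :
    Integrable (fun ω => (1 / (n : ℝ) * ∑ i, g (θ i ω)) ^ 2) μ ∧
      ∫ ω, (1 / (n : ℝ) * ∑ i, g (θ i ω)) ^ 2 ∂μ = (∫ t, g t ^ 2 ∂P) / n := by
  have hn0 : (0 : ℝ) < n := by exact_mod_cast hn
  have : IsProbabilityMeasure (P.map g) := Measure.isProbabilityMeasure_map hg.aemeasurable
  have hL : MemLp id 3 (P.map g) :=
    (memLp_map_measure_iff aestronglyMeasurable_id hg.aemeasurable).2 h3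
  have hind' : iIndepFun (fun i ω => g (θ i ω)) μ := hind.comp (fun _ => g) fun _ => hg
  have e1 : ∫ x, x ∂(P.map g) = 0 := by
    rw [integral_map hg.aemeasurable (by fun_prop), h0]
  have e2 : ∫ x, x ^ 2 ∂(P.map g) = ∫ t, g t ^ 2 ∂P :=
    integral_map hg.aemeasurable (by fun_prop)
  have h := integral_sq_sum (hasLaw_comp hlaw hg) hind' hL e1 Finset.univ
  have hi := ((memLp_sum_of_law (hasLaw_comp hlaw hg) hL Finset.univ).mono_exponent
    (p := 2) (by norm_num)).integrable_sq
  simp_rw [mul_pow]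
  refine ⟨hi.const_mul _, ?_⟩
  rw [integral_const_mul, h, e2, Finset.card_univ, Fintype.card_fin]
  field_simp

end Sample

/-! ### The standardized vector -/

open Matrix

section Standardize

variable {d : ℕ} {P : Measure (Fin d → ℝ)}

lemma sqrt_mul_sqrt_covMat (hpos : (covMat P).PosDef) :
    CFC.sqrt (covMat P) * CFC.sqrt (covMat P) = covMat P :=
  CFC.sqrt_mul_sqrt_self _ hpos.posSemidef.nonneg

lemma transpose_sqrt_covMat : (CFC.sqrt (covMat P))ᵀ = CFC.sqrt (covMat P) := by
  have h := (Matrix.nonneg_iff_posSemidef.1 (CFC.sqrt_nonneg (covMat P))).isHermitian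
  simpa [Matrix.IsHermitian] using h

lemma isUnit_det_sqrt_covMat (hpos : (covMat P).PosDef) :
    IsUnit (CFC.sqrt (covMat P)).det := by
  have h := hpos.det_pos
  rw [← sqrt_mul_sqrt_covMat hpos, Matrix.det_mul] at h
  exact isUnit_iff_ne_zero.2 fun h0 => by simp [h0] at h

/-- A point is recovered from its standardization, so integrability of the standardized coordinates
carries over to the coordinates themselves. -/
lemma sqrt_mulVec_standardize (hpos : (covMat P).PosDef) (t : Fin d → ℝ) :
    CFC.sqrt (covMat P) *ᵥ standardize P t = t - meanVec P := by
  rw [standardize, Matrix.mulVec_mulVec, Matrix.mul_nonsing_inv _ (isUnit_det_sqrt_covMat hpos),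
    Matrix.one_mulVec]

lemma measurable_standardize (j : Fin d) : Measurable fun t => standardize P t j := by
  unfold standardize Matrix.mulVec dotProduct
  simp only [Pi.sub_apply]
  fun_prop

lemma memLp_standardize (hint : ∀ j, Integrable (fun t => standardize P t j ^ 6) P)
    (j : Fin d) : MemLp (fun t => standardize P t j) 6 P := by
  rw [← integrable_norm_rpow_iff (measurable_standardize j).aestronglyMeasurable (by norm_num)
    (by norm_num)]
  refine (hint j).congr (ae_of_all _ fun t => ?_)
  simp only [Real.norm_eq_abs, ENNReal.toReal_ofNat]
  rw [← Even.pow_abs (by decide : Even 6)]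
  exact (Real.rpow_natCast |standardize P t j| 6).symm

lemma memLp_coord_sub_mean (hpos : (covMat P).PosDef)
    (hint : ∀ j, Integrable (fun t => standardize P t j ^ 6) P) (j : Fin d) :
    MemLp (fun t : Fin d → ℝ => t j - meanVec P j) 6 P := by
  have e : (fun t : Fin d → ℝ => t j - meanVec P j)
      = fun t => ∑ k, CFC.sqrt (covMat P) j k * standardize P t k := by
    funext t
    exact (congrFun (sqrt_mulVec_standardize hpos t) j).symm
  rw [e]
  exact memLp_finsetSum _ fun k _ => (memLp_standardize hint k).const_mul _

variable [IsProbabilityMeasure P]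

lemma integral_standardize (hpos : (covMat P).PosDef)
    (hint : ∀ j, Integrable (fun t => standardize P t j ^ 6) P) (j : Fin d) :
    ∫ t, standardize P t j ∂P = 0 := by
  have hi : ∀ k, Integrable (fun t : Fin d → ℝ => t k - meanVec P k) P := fun k =>
    (memLp_coord_sub_mean hpos hint k).integrable (by norm_num)
  have h0 : ∀ k, ∫ t : Fin d → ℝ, (t k - meanVec P k) ∂P = 0 := by
    intro k
    have hk : Integrable (fun t : Fin d → ℝ => t k) P := by
      refine ((hi k).add (integrable_const (meanVec P k))).congr (ae_of_all _ fun t => ?_)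
      simp
    rw [integral_sub hk (integrable_const _)]
    simp [meanVec]
  change ∫ t, ∑ k, (CFC.sqrt (covMat P))⁻¹ j k * (t k - meanVec P k) ∂P = 0
  rw [integral_finsetSum _ fun k _ => (hi k).const_mul _]
  simp [integral_const_mul, h0]

lemma integral_standardize_mul (hpos : (covMat P).PosDef)
    (hint : ∀ j, Integrable (fun t => standardize P t j ^ 6) P) (j k : Fin d) :
    ∫ t, standardize P t j * standardize P t k ∂P = (1 : Matrix (Fin d) (Fin d) ℝ) j k := by
  set S := CFC.sqrt (covMat P) with hS
  have hL : ∀ k, MemLp (fun t : Fin d → ℝ => t k - meanVec P k) 2 P := fun k =>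
    (memLp_coord_sub_mean hpos hint k).mono_exponent (by norm_num)
  have hi : ∀ a b, Integrable
      (fun t : Fin d → ℝ => (t a - meanVec P a) * (t b - meanVec P b)) P := fun a b =>
    (hL a).integrable_mul (hL b)
  have e : ∀ t, standardize P t j * standardize P t k
      = ∑ a, ∑ b, S⁻¹ j a * S⁻¹ k b * ((t a - meanVec P a) * (t b - meanVec P b)) := by
    intro t
    change (∑ a, S⁻¹ j a * (t a - meanVec P a)) * (∑ b, S⁻¹ k b * (t b - meanVec P b)) = _
    rw [Finset.sum_mul_sum]
    refine Finset.sum_congr rfl fun a _ => Finset.sum_congr rfl fun b _ => ?_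
    ring
  simp_rw [e]
  rw [integral_finsetSum _ fun a _ => integrable_finsetSum _ fun b _ => (hi a b).const_mul _]
  have e2 : ∀ a, ∫ t : Fin d → ℝ, ∑ b, S⁻¹ j a * S⁻¹ k b *
      ((t a - meanVec P a) * (t b - meanVec P b)) ∂P
      = ∑ b, S⁻¹ j a * S⁻¹ k b * covMat P a b := by
    intro a
    rw [integral_finsetSum _ fun b _ => (hi a b).const_mul _]
    refine Finset.sum_congr rfl fun b _ => ?_
    rw [integral_const_mul]
    rfl
  simp_rw [e2]
  have hu := isUnit_det_sqrt_covMat hpos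
  have e3 : S⁻¹ * covMat P * S⁻¹ᵀ = 1 := by
    have hSS : covMat P = S * S := (sqrt_mul_sqrt_covMat hpos).symm
    rw [Matrix.transpose_nonsing_inv, transpose_sqrt_covMat, ← hS, hSS, ← Matrix.mul_assoc,
      Matrix.nonsing_inv_mul _ hu, Matrix.one_mul,
      Matrix.mul_nonsing_inv _ hu]
  rw [← e3, Matrix.mul_apply]
  simp_rw [Matrix.mul_apply, Finset.sum_mul, Matrix.transpose_apply]
  rw [Finset.sum_comm]
  refine Finset.sum_congr rfl fun a _ => Finset.sum_congr rfl fun b _ => ?_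
  ring

end Standardize

/-! ### Moments of the entries of the standardized second-moment matrix -/

section Entries

variable {E : Type*} [MeasurableSpace E] {P : Measure E}

/-- With unit second and sixth moment at most `b³`, the fourth moment is at most `(b² + b) / 2`. -/
lemma integral_pow_four_le {f : E → ℝ} {b : ℝ} (hb : 1 ≤ b)
    (hf6 : Integrable (fun t => f t ^ 6) P) (h4i : Integrable (fun t => f t ^ 4) P)
    (h2i : Integrable (fun t => f t ^ 2) P) (h2 : ∫ t, f t ^ 2 ∂P = 1)
    (hτ : ∫ t, f t ^ 6 ∂P ≤ b ^ 3) : ∫ t, f t ^ 4 ∂P ≤ (b ^ 2 + b) / 2 := by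
  have hb0 : 0 < b := by linarith
  have hpt : ∀ t, f t ^ 4 ≤ b ^ 2 / 2 * f t ^ 2 + 1 / (2 * b ^ 2) * f t ^ 6 := fun t => by
    have e : b ^ 2 / 2 * f t ^ 2 + 1 / (2 * b ^ 2) * f t ^ 6 - f t ^ 4
        = f t ^ 2 * (f t ^ 2 - b ^ 2) ^ 2 / (2 * b ^ 2) := by
      field_simp; ring
    have : 0 ≤ f t ^ 2 * (f t ^ 2 - b ^ 2) ^ 2 / (2 * b ^ 2) := by positivity
    linarith
  refine (integral_mono h4i ((h2i.const_mul _).add (hf6.const_mul _)) hpt).trans ?_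
  simp only [Pi.add_apply]
  rw [integral_add (h2i.const_mul _) (hf6.const_mul _), integral_const_mul, integral_const_mul, h2]
  have : 1 / (2 * b ^ 2) * ∫ t, f t ^ 6 ∂P ≤ 1 / (2 * b ^ 2) * b ^ 3 := by gcongr
  have e : 1 / (2 * b ^ 2) * b ^ 3 = b / 2 := by field_simp
  linarith

/-- Second and third moments of a product of two standardized coordinates. -/
lemma integral_offdiag_moments {f g : E → ℝ} {b : ℝ} (hb : 1 ≤ b) (hf : MemLp f 6 P)
    (hg : MemLp g 6 P) (hf6 : Integrable (fun t => f t ^ 6) P)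
    (hg6 : Integrable (fun t => g t ^ 6) P)
    (h4f : Integrable (fun t => f t ^ 4) P) (h4g : Integrable (fun t => g t ^ 4) P)
    (h2fi : Integrable (fun t => f t ^ 2) P) (h2gi : Integrable (fun t => g t ^ 2) P)
    (h2f : ∫ t, f t ^ 2 ∂P = 1) (h2g : ∫ t, g t ^ 2 ∂P = 1)
    (hτf : ∫ t, f t ^ 6 ∂P ≤ b ^ 3) (hτg : ∫ t, g t ^ 6 ∂P ≤ b ^ 3) :
    Integrable (fun t => |f t * g t| ^ 3) P ∧ ∫ t, (f t * g t) ^ 2 ∂P ≤ b ^ 2 ∧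
      ∫ t, |f t * g t| ^ 3 ∂P ≤ b ^ 3 := by
  have hfm := hf.aestronglyMeasurable
  have hgm := hg.aestronglyMeasurable
  have hpt3 : ∀ t, |f t * g t| ^ 3 ≤ f t ^ 6 / 2 + g t ^ 6 / 2 := fun t => by
    rw [abs_mul, ← Even.pow_abs (by decide : Even 6) (f t),
      ← Even.pow_abs (by decide : Even 6) (g t)]
    nlinarith [sq_nonneg (|f t| ^ 3 - |g t| ^ 3)]
  have hpt2 : ∀ t, (f t * g t) ^ 2 ≤ f t ^ 4 / 2 + g t ^ 4 / 2 := fun t => by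
    nlinarith [sq_nonneg (f t ^ 2 - g t ^ 2)]
  have i3 : Integrable (fun t => |f t * g t| ^ 3) P := by
    refine ((hf6.div_const 2).add (hg6.div_const 2)).mono'
      ((hfm.mul hgm).norm.pow 3) (ae_of_all _ fun t => ?_)
    rw [Real.norm_eq_abs, abs_of_nonneg (by positivity)]
    exact hpt3 t
  refine ⟨i3, ?_, ?_⟩
  · have h := integral_mono_of_nonneg (ae_of_all P fun t => sq_nonneg (f t * g t))
      ((h4f.div_const 2).add (h4g.div_const 2)) (ae_of_all _ hpt2)
    simp only [Pi.add_apply] at h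
    rw [integral_add (h4f.div_const 2) (h4g.div_const 2), integral_div, integral_div] at h
    have h1 := integral_pow_four_le hb hf6 h4f h2fi h2f hτf
    have h2 := integral_pow_four_le hb hg6 h4g h2gi h2g hτg
    nlinarith
  · have h := integral_mono i3 ((hf6.div_const 2).add (hg6.div_const 2)) hpt3
    simp only [Pi.add_apply] at h
    rw [integral_add (hf6.div_const 2) (hg6.div_const 2), integral_div, integral_div] at h
    linarith

variable [IsProbabilityMeasure P]

lemma one_le_of_integral_sq {f : E → ℝ} {τ : ℝ} (hf6 : Integrable (fun t => f t ^ 6) P)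
    (h2i : Integrable (fun t => f t ^ 2) P) (h2 : ∫ t, f t ^ 2 ∂P = 1)
    (hτ : ∫ t, f t ^ 6 ∂P ≤ τ) : 1 ≤ τ := by
  have hpt : ∀ t, 3 * f t ^ 2 - 2 ≤ f t ^ 6 := fun t => by
    nlinarith [mul_nonneg (sq_nonneg (f t ^ 2 - 1)) (show 0 ≤ f t ^ 2 + 2 by positivity)]
  have h := integral_mono ((h2i.const_mul 3).sub (integrable_const (2 : ℝ))) hf6 hpt
  simp only [Pi.sub_apply] at h
  rw [integral_sub (h2i.const_mul 3) (integrable_const _), integral_const_mul, h2] at h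
  simp only [integral_const, probReal_univ, one_smul] at h
  linarith

/-- Second and third moments of a centred squared coordinate. The variance is at most `(9/10)²`
times the off-diagonal bound `b²`, for which the subtraction of `1` is essential. -/
lemma integral_diag_moments {f : E → ℝ} {b : ℝ} (hb : 1 ≤ b) (hf : MemLp f 6 P)
    (hf6 : Integrable (fun t => f t ^ 6) P) (h4f : Integrable (fun t => f t ^ 4) P)
    (h2fi : Integrable (fun t => f t ^ 2) P) (h2f : ∫ t, f t ^ 2 ∂P = 1)
    (hτf : ∫ t, f t ^ 6 ∂P ≤ b ^ 3) :
    Integrable (fun t => |f t ^ 2 - 1| ^ 3) P ∧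
      ∫ t, (f t ^ 2 - 1) ^ 2 ∂P ≤ (9 / 10 * b) ^ 2 ∧ ∫ t, |f t ^ 2 - 1| ^ 3 ∂P ≤ b ^ 3 := by
  have hfm := hf.aestronglyMeasurable
  -- Subtracting `y - 1`, which has mean zero for `y = f²`, keeps the bound at `y³`.
  have hpt3 : ∀ t, |f t ^ 2 - 1| ^ 3 ≤ f t ^ 6 - (f t ^ 2 - 1) := fun t => by
    have hy : ∀ y : ℝ, 0 ≤ y → |y - 1| ^ 3 ≤ y ^ 3 - (y - 1) := by
      intro y hy
      rcases le_total 1 y with h | h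
      · rw [abs_of_nonneg (by linarith)]
        nlinarith [sq_nonneg (3 * y - 2)]
      · rw [abs_of_nonpos (by linarith)]
        nlinarith [mul_nonneg hy (sq_nonneg (4 * y - 3))]
    have := hy (f t ^ 2) (sq_nonneg _)
    calc _ ≤ _ := this
      _ = _ := by ring
  have ib : Integrable (fun t => f t ^ 6 - (f t ^ 2 - 1)) P :=
    hf6.sub (h2fi.sub (integrable_const 1))
  have i21 : Integrable (fun t => f t ^ 2 - 1) P := h2fi.sub (integrable_const 1)
  have i3 : Integrable (fun t => |f t ^ 2 - 1| ^ 3) P := by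
    refine ib.mono' (((hfm.pow 2).sub aestronglyMeasurable_const).norm.pow 3)
      (ae_of_all _ fun t => ?_)
    rw [Real.norm_eq_abs, abs_of_nonneg (by positivity)]
    exact hpt3 t
  have hz : ∫ t, (f t ^ 2 - 1) ∂P = 0 := by
    rw [integral_sub h2fi (integrable_const _), h2f]
    simp
  refine ⟨i3, ?_, ?_⟩
  · have e : ∀ t, (f t ^ 2 - 1) ^ 2 = f t ^ 4 - 2 * (f t ^ 2 - 1) - 1 := fun t => by ring
    simp_rw [e]
    have i4 : Integrable (fun t => f t ^ 4 - 2 * (f t ^ 2 - 1)) P := h4f.sub (i21.const_mul 2)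
    rw [integral_sub i4 (integrable_const _), integral_sub h4f (i21.const_mul 2),
      integral_const_mul, hz]
    have h1 := integral_pow_four_le hb hf6 h4f h2fi h2f hτf
    simp only [integral_const, probReal_univ, one_smul]
    nlinarith [sq_nonneg (b - 1)]
  · refine (integral_mono i3 ib hpt3).trans ?_
    rw [integral_sub hf6 i21, hz]
    linarith

end Entries

/-! ### From entries to the Loewner order -/

section Matrices

variable {n d : ℕ}

/-- A quadratic form with entries at most `x`, and at most `9/10 x` on the diagonal, has operator
norm at most `(d - 1/10) x`. The gain over `d x` pays for centring at the sample mean. -/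
lemma abs_quadratic_le {M : Fin d → Fin d → ℝ} {x : ℝ} (hx : 0 ≤ x)
    (hdiag : ∀ j, |M j j| ≤ 9 / 10 * x) (hoff : ∀ j k, j ≠ k → |M j k| ≤ x) (u : Fin d → ℝ) :
    |∑ j, ∑ k, u j * u k * M j k| ≤ (d - 1 / 10) * x * ∑ j, u j ^ 2 := by
  have hpt : ∀ j k, |u j * u k * M j k|
      ≤ x * (|u j| * |u k|) - if j = k then 1 / 10 * x * u j ^ 2 else 0 := by
    intro j k
    rw [abs_mul, abs_mul]
    split_ifs with h
    · subst h
      have := mul_le_mul_of_nonneg_left (hdiag j) (mul_nonneg (abs_nonneg (u j)) (abs_nonneg (u j)))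
      rw [← sq_abs (u j)]
      nlinarith
    · have := mul_le_mul_of_nonneg_left (hoff j k h)
        (mul_nonneg (abs_nonneg (u j)) (abs_nonneg (u k)))
      linarith
  have h1 : |∑ j, ∑ k, u j * u k * M j k|
      ≤ ∑ j, ∑ k, (x * (|u j| * |u k|) - if j = k then 1 / 10 * x * u j ^ 2 else 0) :=
    (Finset.abs_sum_le_sum_abs _ _).trans (Finset.sum_le_sum fun j _ =>
      (Finset.abs_sum_le_sum_abs _ _).trans (Finset.sum_le_sum fun k _ => hpt j k))
  have h2 : ∑ j, ∑ k, (x * (|u j| * |u k|) - if j = k then 1 / 10 * x * u j ^ 2 else 0)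
      = x * (∑ j, |u j|) ^ 2 - 1 / 10 * x * ∑ j, u j ^ 2 := by
    simp only [Finset.sum_sub_distrib, Finset.sum_ite_eq, Finset.mem_univ, if_true]
    rw [sq, Finset.sum_mul_sum]
    simp_rw [Finset.mul_sum]
  have h3 : (∑ j, |u j|) ^ 2 ≤ d * ∑ j, u j ^ 2 := by
    have := sq_sum_le_card_mul_sum_sq (s := Finset.univ) (f := fun j => |u j|)
    simpa using this
  have := mul_le_mul_of_nonneg_left h3 hx
  linarith

lemma dotProduct_sampleCov_mulVec (x : Fin n → Fin d → ℝ) (v : Fin d → ℝ) :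
    v ⬝ᵥ sampleCov x *ᵥ v = 1 / (n : ℝ) * ∑ i, (v ⬝ᵥ (x i - sampleMean x)) ^ 2 := by
  rw [sampleCov, Matrix.smul_mulVec, dotProduct_smul, Matrix.sum_mulVec, dotProduct_sum,
    smul_eq_mul]
  congr 1
  refine Finset.sum_congr rfl fun i _ => ?_
  rw [Matrix.vecMulVec_mulVec, op_smul_eq_smul, dotProduct_smul, smul_eq_mul,
    dotProduct_comm _ v, sq]

lemma isHermitian_sampleCov (x : Fin n → Fin d → ℝ) : (sampleCov x).IsHermitian := by
  ext j k
  simp [sampleCov, Matrix.sum_apply, Matrix.vecMulVec_apply, mul_comm]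

/-- The variance decomposition of the quadratic form of the sample covariance. -/
lemma average_sq_sub_mean (hn : 1 ≤ n) (y : Fin n → Fin d → ℝ) (u : Fin d → ℝ) :
    1 / (n : ℝ) * ∑ i, (u ⬝ᵥ (y i - sampleMean y)) ^ 2
      = ∑ j, u j ^ 2 + ∑ j, ∑ k, u j * u k *
          (1 / (n : ℝ) * ∑ i, (y i j * y i k - (1 : Matrix (Fin d) (Fin d) ℝ) j k))
        - (u ⬝ᵥ sampleMean y) ^ 2 := by
  have hn0 : (n : ℝ) ≠ 0 := by positivity
  have hmean : ∑ i, u ⬝ᵥ y i = n * (u ⬝ᵥ sampleMean y) := by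
    rw [sampleMean, dotProduct_smul, dotProduct_sum, smul_eq_mul]
    field_simp
  have hquad : ∑ j, ∑ k, u j * u k *
        (1 / (n : ℝ) * ∑ i, (y i j * y i k - (1 : Matrix (Fin d) (Fin d) ℝ) j k))
      = 1 / (n : ℝ) * ∑ i, (u ⬝ᵥ y i) ^ 2 - ∑ j, u j ^ 2 := by
    have e1 : ∀ j k, u j * u k *
        (1 / (n : ℝ) * ∑ i, (y i j * y i k - (1 : Matrix (Fin d) (Fin d) ℝ) j k))
        = 1 / (n : ℝ) * ∑ i, (u j * y i j) * (u k * y i k)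
          - u j * u k * (1 : Matrix (Fin d) (Fin d) ℝ) j k := by
      intro j k
      rw [Finset.sum_sub_distrib, Finset.sum_const, Finset.card_univ, Fintype.card_fin,
        nsmul_eq_mul]
      have e2 : ∑ i, (u j * y i j) * (u k * y i k) = u j * u k * ∑ i, y i j * y i k := by
        rw [Finset.mul_sum]
        exact Finset.sum_congr rfl fun i _ => by ring
      rw [e2]
      field_simp
    simp_rw [e1, Finset.sum_sub_distrib, ← Finset.mul_sum]
    congr 1
    · congr 1
      have e3 : ∀ i, (u ⬝ᵥ y i) ^ 2 = ∑ j, ∑ k, (u j * y i j) * (u k * y i k) := fun i => by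
        rw [sq, dotProduct, Finset.sum_mul_sum]
      simp_rw [e3]
      rw [Finset.sum_comm (s := Finset.univ (α := Fin n))]
      exact Finset.sum_congr rfl fun j _ => Finset.sum_comm
    · simp [Matrix.one_apply, sq]
  rw [hquad]
  have e4 : ∀ i, (u ⬝ᵥ (y i - sampleMean y)) ^ 2 = (u ⬝ᵥ y i) ^ 2
      - 2 * (u ⬝ᵥ sampleMean y) * (u ⬝ᵥ y i) + (u ⬝ᵥ sampleMean y) ^ 2 := fun i => by
    rw [dotProduct_sub]; ring
  simp_rw [e4]
  rw [Finset.sum_add_distrib, Finset.sum_sub_distrib, ← Finset.mul_sum, hmean]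
  simp only [Finset.sum_const, Finset.card_univ, Fintype.card_fin, nsmul_eq_mul]
  field_simp
  ring

end Matrices

section Loewner

variable {n d : ℕ} {P : Measure (Fin d → ℝ)}

lemma sub_sampleMean_eq (hpos : (covMat P).PosDef) (hn : 1 ≤ n) (x : Fin n → Fin d → ℝ)
    (i : Fin n) :
    x i - sampleMean x = CFC.sqrt (covMat P) *ᵥ
      (standardize P (x i) - sampleMean fun i => standardize P (x i)) := by
  have hn0 : (n : ℝ) ≠ 0 := by positivity
  have h : ∀ i, CFC.sqrt (covMat P) *ᵥ standardize P (x i) = x i - meanVec P := fun i =>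
    sqrt_mulVec_standardize hpos (x i)
  rw [Matrix.mulVec_sub, h, sampleMean, sampleMean, Matrix.mulVec_smul, Matrix.mulVec_sum]
  simp_rw [h]
  rw [Finset.sum_sub_distrib, smul_sub, Finset.sum_const, Finset.card_univ, Fintype.card_fin,
    ← Nat.cast_smul_eq_nsmul ℝ n, smul_smul, one_div, inv_mul_cancel₀ hn0, one_smul]
  abel

/-- Entrywise control of the standardized second-moment matrix and of the standardized sample
mean gives two-sided control of the sample covariance in the Loewner order. -/
lemma loewner_of_entries (hpos : (covMat P).PosDef) (hn : 1 ≤ n) (x : Fin n → Fin d → ℝ)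
    {r : ℝ} (hr : 0 ≤ r)
    (hdiag : ∀ j, |1 / (n : ℝ) * ∑ i, (standardize P (x i) j * standardize P (x i) j
      - (1 : Matrix (Fin d) (Fin d) ℝ) j j)| ≤ 9 / 10 * r)
    (hoff : ∀ j k, j ≠ k → |1 / (n : ℝ) * ∑ i, (standardize P (x i) j * standardize P (x i) k
      - (1 : Matrix (Fin d) (Fin d) ℝ) j k)| ≤ r)
    (hmean : ∑ j, (1 / (n : ℝ) * ∑ i, standardize P (x i) j) ^ 2 ≤ 1 / 10 * r) :
    (1 - d * r) • covMat P ≤ sampleCov x ∧ sampleCov x ≤ (1 + d * r) • covMat P := by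
  set S := CFC.sqrt (covMat P) with hS
  have hSS : covMat P = S * S := (sqrt_mul_sqrt_covMat hpos).symm
  have hdot : ∀ v w : Fin d → ℝ, v ⬝ᵥ S *ᵥ w = (S *ᵥ v) ⬝ᵥ w := fun v w => by
    rw [Matrix.dotProduct_mulVec, ← Matrix.mulVec_transpose, hS, transpose_sqrt_covMat]
  set y : Fin n → Fin d → ℝ := fun i => standardize P (x i) with hy
  have hcov : ∀ v : Fin d → ℝ, v ⬝ᵥ covMat P *ᵥ v = ∑ j, (S *ᵥ v) j ^ 2 := fun v => by
    rw [hSS, ← Matrix.mulVec_mulVec, hdot]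
    simp [dotProduct, sq]
  have hbound : ∀ v : Fin d → ℝ,
      |v ⬝ᵥ sampleCov x *ᵥ v - v ⬝ᵥ covMat P *ᵥ v| ≤ d * r * (v ⬝ᵥ covMat P *ᵥ v) := by
    intro v
    rw [dotProduct_sampleCov_mulVec, hcov]
    simp_rw [sub_sampleMean_eq hpos hn x, ← hS, hdot]
    set u := S *ᵥ v
    rw [average_sq_sub_mean hn y u]
    have hq := abs_quadratic_le hr hdiag hoff u
    have hm : (u ⬝ᵥ sampleMean y) ^ 2 ≤ 1 / 10 * r * ∑ j, u j ^ 2 := by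
      have hcs := Finset.sum_mul_sq_le_sq_mul_sq Finset.univ u (sampleMean y)
      have e : ∑ j, sampleMean y j ^ 2 = ∑ j, (1 / (n : ℝ) * ∑ i, standardize P (x i) j) ^ 2 := by
        simp [sampleMean, hy]
      rw [e] at hcs
      have hu : 0 ≤ ∑ j, u j ^ 2 := Finset.sum_nonneg fun j _ => sq_nonneg _
      have := mul_le_mul_of_nonneg_left hmean hu
      refine hcs.trans ?_
      linarith
    have h0 := sq_nonneg (u ⬝ᵥ sampleMean y)
    rw [abs_le] at hq ⊢
    constructor <;> linarith [hq.1, hq.2]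
  have hH := isHermitian_sampleCov x
  have hHc := hpos.isHermitian
  have hHs : ∀ c : ℝ, (c • covMat P).IsHermitian := fun c => by
    rw [Matrix.IsHermitian, Matrix.conjTranspose_smul, hHc.eq]; simp
  rw [Matrix.le_iff, Matrix.le_iff, Matrix.posSemidef_iff_dotProduct_mulVec,
    Matrix.posSemidef_iff_dotProduct_mulVec]
  refine ⟨⟨hH.sub (hHs _), fun v => ?_⟩, ⟨(hHs _).sub hH, fun v => ?_⟩⟩
  all_goals
    have h := abs_le.1 (hbound v)
    rw [star_trivial, Matrix.sub_mulVec, dotProduct_sub, Matrix.smul_mulVec, dotProduct_smul,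
      smul_eq_mul]
    linarith [h.1, h.2]

end Loewner

/-! ### Probabilities of the exceptional events -/

section Probability

variable {Ω : Type*} [MeasurableSpace Ω] {μ : Measure Ω} [IsProbabilityMeasure μ] {n d : ℕ}
  {P : Measure (Fin d → ℝ)} [IsProbabilityMeasure P] {θ : Fin n → Ω → (Fin d → ℝ)}

/-- The relative tolerance, in units of the off-diagonal one, for each entry of the standardized
second-moment matrix. -/
noncomputable def entryScale {d : ℕ} (j k : Fin d) : ℝ := if j = k then 9 / 10 else 1

/-- Each entry of the standardized second-moment matrix exceeds its tolerance with probability at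
most the Gaussian tail plus `312 / √n`. A diagonal tolerance of `9/10` is affordable because the
variance of a squared coordinate is small; the cube of `10/9` is the price in the error. -/
lemma measureReal_entry_le (hn : 1 ≤ n) (hpos : (covMat P).PosDef)
    (hint : ∀ j, Integrable (fun t => standardize P t j ^ 6) P) {b : ℝ} (hb : 1 ≤ b)
    (hτ : ∀ j, ∫ t, standardize P t j ^ 6 ∂P ≤ b ^ 3)
    (hlaw : ∀ i, HasLaw (θ i) P μ) (hind : iIndepFun θ μ) {q : ℝ} (hq : 3 / 5 ≤ q)
    (hT : normalTail q ≤ 1 / 2) (j k : Fin d) :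
    μ.real {ω | entryScale j k * b * q / √n < |1 / (n : ℝ) * ∑ i,
      (standardize P (θ i ω) j * standardize P (θ i ω) k - (1 : Matrix (Fin d) (Fin d) ℝ) j k)|}
      ≤ normalTail q + 312 / √n := by
  have hL := memLp_standardize hint
  have hm : ∀ j, Measurable fun t => standardize P t j := measurable_standardize
  have i2 : ∀ j, Integrable (fun t => standardize P t j ^ 2) P := fun j =>
    ((hL j).mono_exponent (p := 2) (by norm_num)).integrable_sq
  have i4 : ∀ j, Integrable (fun t => standardize P t j ^ 4) P := fun j => by
    have := ((hL j).mono_exponent (p := 4) (by norm_num)).integrable_norm_pow (p := 4)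
      (by norm_num)
    simpa [Even.pow_abs (show Even 4 by decide)] using this
  have h2 : ∀ j, ∫ t, standardize P t j ^ 2 ∂P = 1 := fun j => by
    have := integral_standardize_mul hpos hint j j
    simpa [sq] using this
  have hg : Measurable fun t => standardize P t j * standardize P t k
      - (1 : Matrix (Fin d) (Fin d) ℝ) j k := ((hm j).mul (hm k)).sub_const _
  have hg0 : ∫ t, (standardize P t j * standardize P t k
      - (1 : Matrix (Fin d) (Fin d) ℝ) j k) ∂P = 0 := by
    have hjk : Integrable (fun t => standardize P t j * standardize P t k) P :=
      ((hL j).mono_exponent (p := 2) (by norm_num)).integrable_mul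
        ((hL k).mono_exponent (p := 2) (by norm_num))
    rw [integral_sub hjk (integrable_const _), integral_standardize_mul hpos hint]
    simp
  have hmom : Integrable (fun t => |standardize P t j * standardize P t k
        - (1 : Matrix (Fin d) (Fin d) ℝ) j k| ^ 3) P ∧
      ∫ t, (standardize P t j * standardize P t k
        - (1 : Matrix (Fin d) (Fin d) ℝ) j k) ^ 2 ∂P ≤ (entryScale j k * b) ^ 2 ∧
      ∫ t, |standardize P t j * standardize P t k
        - (1 : Matrix (Fin d) (Fin d) ℝ) j k| ^ 3 ∂P ≤ b ^ 3 := by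
    by_cases h : j = k
    · subst h
      have := integral_diag_moments hb (hL j) (hint j) (i4 j) (i2 j) (h2 j) (hτ j)
      simpa only [Matrix.one_apply_eq, ← sq, entryScale, if_true] using this
    · have := integral_offdiag_moments hb (hL j) (hL k) (hint j) (hint k) (i4 j) (i4 k) (i2 j)
        (i2 k) (h2 j) (h2 k) (hτ j) (hτ k)
      simpa only [Matrix.one_apply_ne h, sub_zero, entryScale, h, if_false, one_mul] using this
  have hs : 9 / 10 ≤ entryScale j k := by
    unfold entryScale; split_ifs <;> norm_num
  have hκ : b ^ 3 ≤ 1000 / 729 * (entryScale j k * b) ^ 3 := by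
    have : (9 / 10 * b) ^ 3 ≤ (entryScale j k * b) ^ 3 := by gcongr
    linarith
  have h := measureReal_lt_abs_average_le hn hlaw hind hg hmom.1 hg0
    (σ := entryScale j k * b) (by positivity) hmom.2.1 (hmom.2.2.trans hκ) hq hT
  refine h.trans ?_
  have : 227 * (1000 / 729 / √(n : ℝ)) ≤ 312 / √n := by
    rw [← mul_div_assoc]
    gcongr
    norm_num
  linarith

/-- Markov's inequality for the squared norm of the standardized sample mean. -/
lemma measureReal_mean_le (hn : 1 ≤ n) (hpos : (covMat P).PosDef)
    (hint : ∀ j, Integrable (fun t => standardize P t j ^ 6) P)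
    (hlaw : ∀ i, HasLaw (θ i) P μ) (hind : iIndepFun θ μ) {ε : ℝ} (hε : 0 < ε) :
    μ.real {ω | ε < ∑ j, (1 / (n : ℝ) * ∑ i, standardize P (θ i ω) j) ^ 2} ≤ d / n / ε := by
  have hL : ∀ j, MemLp (fun t => standardize P t j) 3 P := fun j =>
    (memLp_standardize hint j).mono_exponent (by norm_num)
  have h2 : ∀ j, ∫ t, standardize P t j ^ 2 ∂P = 1 := fun j => by
    have := integral_standardize_mul hpos hint j j
    simpa [sq] using this
  have hav := fun j => integral_average_sq hn hlaw hind (measurable_standardize j) (hL j)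
    (integral_standardize hpos hint j)
  have hi : Integrable (fun ω => ∑ j, (1 / (n : ℝ) * ∑ i, standardize P (θ i ω) j) ^ 2) μ :=
    integrable_finsetSum _ fun j _ => (hav j).1
  have hE : ∫ ω, ∑ j, (1 / (n : ℝ) * ∑ i, standardize P (θ i ω) j) ^ 2 ∂μ = (d : ℝ) / n := by
    rw [integral_finsetSum _ fun j _ => (hav j).1]
    simp_rw [fun j => (hav j).2, h2]
    simp [div_eq_mul_inv]
  have hM := mul_meas_ge_le_integral_of_nonneg
    (ae_of_all μ fun ω => Finset.sum_nonneg fun j _ =>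
      sq_nonneg (1 / (n : ℝ) * ∑ i, standardize P (θ i ω) j)) hi ε
  rw [hE] at hM
  rw [le_div_iff₀ hε, mul_comm]
  refine (mul_le_mul_of_nonneg_left (measureReal_mono fun ω hω => ?_) hε.le).trans hM
  exact le_of_lt (Set.mem_ofPred_eq ▸ hω)

end Probability

end SteinTail

open SteinTail

theorem mainTheorem5 {Ω : Type*} [MeasurableSpace Ω] (μ : Measure Ω) [IsProbabilityMeasure μ]
    (d n : ℕ) (hd : 1 ≤ d) (hn : 1 ≤ n)
    (P : Measure (Fin d → ℝ)) [IsProbabilityMeasure P]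
    (hpos : (covMat P).PosDef)
    (τ' : ℝ)
    (hint : ∀ j, Integrable (fun t => standardize P t j ^ 6) P)
    (hτ' : ∀ j, ∫ t, standardize P t j ^ 6 ∂P ≤ τ')
    (θ : Fin n → Ω → (Fin d → ℝ))
    (hlaw : ∀ i, HasLaw (θ i) P μ)
    (hindep : iIndepFun θ μ)
    (δ' : ℝ) (hδ' : 0 < δ')
    (hedge : 2 ≤ d ∨ δ' ≤ 1 / 2)
    (hlevel : covLevel d n τ' δ' < 1) :
    ENNReal.ofReal (1 - δ') ≤
      μ {ω | (1 - covError d n τ' δ') • covMat P ≤ sampleCov (fun i => θ i ω) ∧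
             sampleCov (fun i => θ i ω) ≤ (1 + covError d n τ' δ') • covMat P} := by
  rcases le_or_gt 1 δ' with hδ1 | hδ1
  · rw [ENNReal.ofReal_of_nonpos (by linarith)]
    simp
  have hd1 : (1 : ℝ) ≤ d := by exact_mod_cast hd
  have hn1 : (1 : ℝ) ≤ n := by exact_mod_cast hn
  have hs : 0 < √(n : ℝ) := Real.sqrt_pos.2 (by linarith)
  have hsq : √(n : ℝ) ^ 2 = n := Real.sq_sqrt (by linarith)
  -- The sixth moments are at least the cube of the unit second moments.
  have hτ1 : 1 ≤ τ' := by
    set j : Fin d := ⟨0, hd⟩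
    refine one_le_of_integral_sq (hint j)
      ((memLp_standardize hint j).mono_exponent (p := 2) (by norm_num)).integrable_sq ?_ (hτ' j)
    have := integral_standardize_mul hpos hint j j
    simpa [sq] using this
  set b := τ' ^ (1 / 3 : ℝ) with hb
  have hb1 : 1 ≤ b := Real.one_le_rpow hτ1 (by norm_num)
  have hb3 : b ^ 3 = τ' := by
    rw [hb, ← Real.rpow_natCast, ← Real.rpow_mul (by linarith)]
    norm_num
  set p := covLevel d n τ' δ' with hp
  have hp_eq : p = 1 - δ' / (d : ℝ) ^ 2 + 400 * τ' / √n := by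
    rw [hp, covLevel, beConst]
    simp
  -- The quantile is taken above the median, where it is at least `3/5`.
  have hhalf : 1 / 2 ≤ p := by
    have h1 : 0 ≤ 400 * τ' / √(n : ℝ) := by positivity
    have h2 : δ' / (d : ℝ) ^ 2 ≤ 1 / 2 := by
      rw [div_le_iff₀ (by positivity)]
      rcases hedge with h | h
      · have : (2 : ℝ) ≤ d := by exact_mod_cast h
        nlinarith
      · nlinarith
    linarith
  obtain ⟨hq, hTq⟩ := chiQuantile_one_mem hhalf hlevel
  set q := chiQuantile 1 p with hqdef
  have hq0 : 0 < q := by linarith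
  set r := b * q / √(n : ℝ) with hr
  have hr0 : 0 < r := by positivity
  have herr : covError d n τ' δ' = d * r := by
    rw [covError, ← hp, ← hqdef, ← hb, hr]
    ring
  -- The exceptional events.
  set B : Fin d × Fin d → Set Ω := fun jk => {ω | entryScale jk.1 jk.2 * b * q / √n <
    |1 / (n : ℝ) * ∑ i, (standardize P (θ i ω) jk.1 * standardize P (θ i ω) jk.2
      - (1 : Matrix (Fin d) (Fin d) ℝ) jk.1 jk.2)|} with hB
  set C : Set Ω := {ω | 1 / 10 * r < ∑ j, (1 / (n : ℝ) * ∑ i, standardize P (θ i ω) j) ^ 2}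
    with hC
  set G : Set Ω := {ω | (1 - covError d n τ' δ') • covMat P ≤ sampleCov (fun i => θ i ω) ∧
    sampleCov (fun i => θ i ω) ≤ (1 + covError d n τ' δ') • covMat P} with hG
  have hcover : (Set.univ : Set Ω) ⊆ G ∪ ((⋃ jk ∈ Finset.univ, B jk) ∪ C) := by
    intro ω _
    by_contra hω
    simp only [Set.mem_union, Set.mem_iUnion, not_or, not_exists, Finset.mem_univ,
      forall_true_left] at hω
    obtain ⟨hωG, hωB, hωC⟩ := hω
    refine hωG ?_
    rw [hG, Set.mem_ofPred_eq, herr]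
    have hscale : ∀ s : ℝ, s * b * q / √(n : ℝ) = s * r := fun s => by rw [hr]; ring
    refine loewner_of_entries hpos hn _ hr0.le (fun j => ?_) (fun j k hjk => ?_) (not_lt.1 hωC)
    · have h := hωB (j, j)
      rw [hB, Set.mem_ofPred_eq, not_lt] at h
      rwa [hscale, entryScale, if_pos rfl] at h
    · have h := hωB (j, k)
      rw [hB, Set.mem_ofPred_eq, not_lt] at h
      rwa [hscale, entryScale, if_neg hjk, one_mul] at h
  have hBC : μ.real ((⋃ jk ∈ Finset.univ, B jk) ∪ C) ≤ δ' := by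
    have h1 : μ.real (⋃ jk ∈ Finset.univ, B jk) ≤ d ^ 2 * (normalTail q + 312 / √n) := by
      refine (measureReal_biUnion_finset_le _ _).trans ((Finset.sum_le_sum fun jk _ =>
        measureReal_entry_le hn hpos hint hb1 (fun j => (hτ' j).trans hb3.ge) hlaw hindep hq
          (by linarith) jk.1 jk.2).trans (le_of_eq ?_))
      simp only [Finset.sum_const, Finset.card_univ, Fintype.card_prod, Fintype.card_fin,
        nsmul_eq_mul]
      push_cast
      ring
    have h2 : μ.real C ≤ d * (17 / √n) := by
      refine (measureReal_mean_le hn hpos hint hlaw hindep (by positivity)).trans ?_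
      have hbq : 3 / 5 ≤ b * q := by nlinarith
      calc (d : ℝ) / n / (1 / 10 * r) = d * (10 / (b * q) / √n) := by
            rw [hr]
            nth_rewrite 1 [← hsq]
            field_simp
        _ ≤ d * (17 / √n) := by
            gcongr
            rw [div_le_iff₀ (by positivity)]
            linarith
    have h3 : (d : ℝ) * (17 / √n) ≤ d ^ 2 * (17 / √n) := by
      gcongr
      nlinarith
    have h4 : (d : ℝ) ^ 2 * (normalTail q + 312 / √n + 17 / √n) ≤ d ^ 2 * (δ' / d ^ 2) := by
      gcongr
      have h5 : 312 / √(n : ℝ) + 17 / √n ≤ 400 * τ' / √n := by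
        rw [← add_div]
        gcongr
        linarith
      linarith
    have h6 : (d : ℝ) ^ 2 * (δ' / d ^ 2) = δ' := by field_simp
    refine (measureReal_union_le _ _).trans ?_
    linarith
  have hμ : 1 ≤ μ.real G + δ' := by
    calc (1 : ℝ) = μ.real Set.univ := probReal_univ.symm
      _ ≤ μ.real (G ∪ ((⋃ jk ∈ Finset.univ, B jk) ∪ C)) := measureReal_mono hcover
      _ ≤ μ.real G + μ.real ((⋃ jk ∈ Finset.univ, B jk) ∪ C) := measureReal_union_le _ _
      _ ≤ _ := by gcongr
  refine (ENNReal.ofReal_le_ofReal (show 1 - δ' ≤ μ.real G by linarith)).trans ?_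
  rw [measureReal_def, ENNReal.ofReal_toReal (measure_ne_top _ _)]
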